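/- Let $N\in\mathbb N$, let $\Sigma=\{1,\dots,N\}^{\mathbb N}$, let $\Sigma_n$ be the set of words of length $n$ over $\{1,\dots,N\}$ and $\Sigma_*$ the set of all finite words, including the empty one, and let $[\mathtt i]\subset\Sigma$ be the cylinder of all infinite words with prefix $\mathtt i\in\Sigma_*$. Let $A_1,\dots,A_N\in GL_2(\mathbb R)$ satisfy $\|A_i\|<1$ for every $i$, where $\|\cdot\|$ is the Euclidean operator norm. For $\mathtt i=i_1\cdots i_n$ write $A_{\mathtt i}=A_{i_1}\cdots A_{i_n}$, and let $\alpha_1(\mathtt i)=\|A_{\mathtt i}\|\ge\alpha_2(\mathtt i)=\|A_{\mathtt i}^{-1}\|^{-1}$ be the singular values of $A_{\mathtt i}$. Assume that $(A_1,\dots,A_N)$ is dominated: there are $C>0$ and $0<\tau<1$ such that $\alpha_2(\mathtt i)\le C\tau^{n}\alpha_1(\mathtt i)$ for all $n$ and all $\mathtt i\in\Sigma_n$. Let $\mu$ be a Borel probability measure on $\Sigma$ that is quasi-Bernoulli: $\mu([\mathtt i])>0$ for every $\mathtt i\in\Sigma_*$, and there is $C'\ge1$ such that $C'^{-1}\mu([\mathtt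 i])\mu([\mathtt j])\le\mu([\mathtt i\mathtt j])\le C'\mu([\mathtt i])\mu([\mathtt j])$ for all $\mathtt i,\mathtt j\in\Sigma_*$. For $s\ge0$ let $$\varphi^s(\mathtt i)=\begin{cases}\alpha_1(\mathtt i)^s,&0\le s<1,\\ \alpha_1(\mathtt i)\alpha_2(\mathtt i)^{s-1},&1\le s<2,\\ |\det A_{\mathtt i}|^{s/2},&s\ge2,\end{cases}$$ and for $q\in\mathbb R$ let $\psi^{q,s}(\mathtt i)=\mu([\mathtt i])^q\varphi^s(\mathtt i)^{1-q}$. Then for all $q\in\mathbb R$ and $s\ge0$ the limit $$P(\psi^{q,s})=\lim_{n\to\infty}\frac1n\log\sum_{\mathtt i\in\Sigma_n}\psi^{q,s}(\mathtt i)$$ exists in $\mathbb R$, and the function $(q,s)\mapsto P(\psi^{q,s})$ is differentiable on $\mathbb R\times\big((0,\infty)\setminus\{1,2\}\big)$, as a function of two real variables. -/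

import Mathlib

open MeasureTheory Filter Topology

namespace SymbolicPressure

noncomputable section

/-- The symbolic space of all infinite words over an alphabet with `N` letters. -/
abbrev Shift (N : ℕ) : Type := ℕ → Fin N

/-- The finite words over the alphabet; the empty word is `[]`. -/
abbrev Word (N : ℕ) : Type := List (Fin N)

/-- The prefix of length `n` of an infinite word. -/
def initialWord {N : ℕ} (x : Shift N) (n : ℕ) : Word N :=
  List.ofFn fun k : Fin n => x k

/-- The cylinder set of a finite word. -/
def wordCylinder {N : ℕ} (w : Word N) : Set (Shift N) :=
  {x | initialWord x w.length = w}

/-! ### Potentials -/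

/-- `θ` is sub-multiplicative. -/
def IsSubMultiplicative {N : ℕ} (θ : Word N → ℝ) : Prop :=
  ∀ u v : Word N, θ (u ++ v) ≤ θ u * θ v

/-- `θ` is super-multiplicative: `1 / θ` is sub-multiplicative. -/
def IsSuperMultiplicative {N : ℕ} (θ : Word N → ℝ) : Prop :=
  IsSubMultiplicative fun w => 1 / θ w

/-- `θ` is almost-multiplicative: for some `C ≥ 1`, `C θ` is sub-multiplicative and `C⁻¹ θ` is
super-multiplicative. -/
def IsAlmostMultiplicative {N : ℕ} (θ : Word N → ℝ) : Prop :=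
  ∃ C : ℝ, 1 ≤ C ∧ IsSubMultiplicative (fun w => C * θ w) ∧
    IsSuperMultiplicative (fun w => C⁻¹ * θ w)

/-- The averages `(1 / n) log ∑_{|w| = n} θ(w)`. -/
def logPartition {N : ℕ} (θ : Word N → ℝ) (n : ℕ) : ℝ :=
  (1 / (n : ℝ)) * Real.log (∑ w : Fin n → Fin N, θ (List.ofFn w))

/-- The pressure `P(θ) = lim_n (1 / n) log ∑_{|w| = n} θ(w)`. -/
def pressure {N : ℕ} (θ : Word N → ℝ) : ℝ :=
  limUnder atTop (logPartition θ)

/-! ### Quasi-Bernoulli measures -/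

/-- Every cylinder has positive measure. -/
def IsFullySupported {N : ℕ} (μ : Measure (Shift N)) : Prop :=
  ∀ w : Word N, 0 < μ (wordCylinder w)

/-- A quasi-Bernoulli measure: fully supported, and `w ↦ μ([w])` is almost-multiplicative. -/
def IsQuasiBernoulli {N : ℕ} (μ : Measure (Shift N)) : Prop :=
  IsFullySupported μ ∧ IsAlmostMultiplicative fun w => μ.real (wordCylinder w)

/-! ### Products of matrices and singular values -/

/-- The Euclidean operator norm of a real `2 × 2` matrix. -/
def euclideanOpNorm (M : Matrix (Fin 2) (Fin 2) ℝ) : ℝ :=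
  ‖Matrix.toEuclideanCLM (n := Fin 2) (𝕜 := ℝ) M‖

/-- The product `A_w = A_{w_1} ⋯ A_{w_n}`. -/
def wordProd {N : ℕ} (A : Fin N → GL (Fin 2) ℝ) (w : Word N) : GL (Fin 2) ℝ :=
  (w.map A).prod

/-- The larger singular value `‖A_w‖`. -/
def alphaOne {N : ℕ} (A : Fin N → GL (Fin 2) ℝ) (w : Word N) : ℝ :=
  euclideanOpNorm (wordProd A w : Matrix (Fin 2) (Fin 2) ℝ)

/-- The smaller singular value `‖A_w⁻¹‖⁻¹`. -/
def alphaTwo {N : ℕ} (A : Fin N → GL (Fin 2) ℝ) (w : Word N) : ℝ :=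
  (euclideanOpNorm ((wordProd A w)⁻¹ : GL (Fin 2) ℝ))⁻¹

/-- All matrices are strict contractions in the Euclidean operator norm. -/
def IsContractive {N : ℕ} (A : Fin N → GL (Fin 2) ℝ) : Prop :=
  ∀ i, euclideanOpNorm (A i : Matrix (Fin 2) (Fin 2) ℝ) < 1

/-- The tuple is dominated. -/
def IsDominated {N : ℕ} (A : Fin N → GL (Fin 2) ℝ) : Prop :=
  ∃ C τ : ℝ, 0 < C ∧ 0 < τ ∧ τ < 1 ∧
    ∀ w : Word N, alphaTwo A w ≤ C * τ ^ w.length * alphaOne A w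

/-- The singular value function `φ^s`, for `s ≥ 0`. -/
def singularValueFunction {N : ℕ} (A : Fin N → GL (Fin 2) ℝ) (s : ℝ) (w : Word N) : ℝ :=
  if s < 1 then alphaOne A w ^ s
  else if s < 2 then alphaOne A w * alphaTwo A w ^ (s - 1)
  else |(wordProd A w : Matrix (Fin 2) (Fin 2) ℝ).det| ^ (s / 2)

/-- The potential `ψ^{q,s}(w) = μ([w])^q φ^s(w)^{1-q}`. -/
def psi {N : ℕ} (A : Fin N → GL (Fin 2) ℝ) (μ : Measure (Shift N)) (q s : ℝ) (w : Word N) : ℝ :=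
  μ.real (wordCylinder w) ^ q * singularValueFunction A s w ^ (1 - q)

end

end SymbolicPressure

namespace SymbolicPressure

noncomputable section

/-! ### Sums over words of a given length -/

/-! Since `α₂ = |det| / α₁`, `log ψ^{q,s}` is a linear combination of `log μ([w])`, `log α₁` and
`log |det|`, with coefficients differentiable in `(q, s)` off `s = 1, 2`. All three functions are
almost additive. The pressure is therefore `Q (psiCoeff (q, s))` for a function `Q` on `ℝ³`, and it
suffices that `Q` is differentiable.

Almost additivity of `log α₁` is where domination enters (`IsDominated.exists_mul_alphaOne_le`). If
`A_u A_v` had an exceptionally small norm relative to `‖A_u‖ ‖A_v‖`, shortening `u` and `v` at their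
outer ends would give long words still having almost the same cancellation but moderate singular
ratios. The determinant identity `singularRatio_append` would then force the product of these words
to violate domination.

Differentiability of `Q` at `x` (`differentiable_of_abs_log_partitionSum_le`) uses no transfer
operator. Almost additivity gives `log Z_n = n Q + O(1)` and a stationary Gibbs state `ν` at `x`.
Hence `n (Q (x + y) - Q x)` is, up to a bounded error, the logarithm of the `ν`-mean of `exp G`,
where `G = ∑ y i * f i`. If `n ‖y‖ ≤ s`, then `G` has bounded oscillation on words of length `n`, so
this logarithm is the mean of `G` up to a multiple of its variance. The variance tends to `0` along
`n = 2 ^ k` by a law of large numbers (`IsStationary.tendsto_wordVar`), and the mean is linear in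
`y` up to `O(1)`. The remainder is thus at most `K / n` with `K` independent of `s`; taking `n`
comparable to `s / ‖y‖` with `s` arbitrarily large makes it `o(‖y‖)`. -/

/-- The sum of `F` over all words of length `n`. -/
def wordSum {N : ℕ} (n : ℕ) (F : Word N → ℝ) : ℝ :=
  ∑ w : Fin n → Fin N, F (List.ofFn w)

variable {N : ℕ}

lemma wordSum_le_wordSum {n : ℕ} {F G : Word N → ℝ} (h : ∀ w, w.length = n → F w ≤ G w) :
    wordSum n F ≤ wordSum n G :=
  Finset.sum_le_sum fun _ _ => h _ (List.length_ofFn)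

lemma wordSum_congr {n : ℕ} {F G : Word N → ℝ} (h : ∀ w, w.length = n → F w = G w) :
    wordSum n F = wordSum n G :=
  Finset.sum_congr rfl fun _ _ => h _ (List.length_ofFn)

lemma wordSum_nonneg {n : ℕ} {F : Word N → ℝ} (h : ∀ w, w.length = n → 0 ≤ F w) :
    0 ≤ wordSum n F :=
  Finset.sum_nonneg fun _ _ => h _ (List.length_ofFn)

lemma wordSum_pos [NeZero N] {n : ℕ} {F : Word N → ℝ} (h : ∀ w, w.length = n → 0 < F w) :
    0 < wordSum n F :=
  Finset.sum_pos (fun _ _ => h _ (List.length_ofFn)) Finset.univ_nonempty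

lemma wordSum_const_mul (n : ℕ) (a : ℝ) (F : Word N → ℝ) :
    wordSum n (fun w => a * F w) = a * wordSum n F :=
  (Finset.mul_sum _ _ _).symm

lemma wordSum_mul_const (n : ℕ) (a : ℝ) (F : Word N → ℝ) :
    wordSum n (fun w => F w * a) = wordSum n F * a :=
  (Finset.sum_mul _ _ _).symm

lemma wordSum_div_const (n : ℕ) (a : ℝ) (F : Word N → ℝ) :
    wordSum n (fun w => F w / a) = wordSum n F / a :=
  (Finset.sum_div _ _ _).symm

lemma wordSum_add (n : ℕ) (F G : Word N → ℝ) :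
    wordSum n (fun w => F w + G w) = wordSum n F + wordSum n G :=
  Finset.sum_add_distrib

lemma wordSum_sub (n : ℕ) (F G : Word N → ℝ) :
    wordSum n (fun w => F w - G w) = wordSum n F - wordSum n G :=
  Finset.sum_sub_distrib _ _

lemma wordSum_sum {ι : Type*} (n : ℕ) (s : Finset ι) (F : ι → Word N → ℝ) :
    wordSum n (fun w => ∑ i ∈ s, F i w) = ∑ i ∈ s, wordSum n (F i) :=
  Finset.sum_comm

lemma wordSum_comm (m n : ℕ) (F : Word N → Word N → ℝ) :
    wordSum m (fun u => wordSum n (fun v => F u v)) =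
      wordSum n (fun v => wordSum m (fun u => F u v)) :=
  Finset.sum_comm

lemma tendsto_wordSum {α : Type*} {l : Filter α} {F : α → Word N → ℝ} {G : Word N → ℝ}
    (h : ∀ w, Tendsto (fun a => F a w) l (𝓝 (G w))) (n : ℕ) :
    Tendsto (fun a => wordSum n (F a)) l (𝓝 (wordSum n G)) :=
  tendsto_finsetSum _ fun _ _ => h _

/-- A sum over words of length `m + n` is a sum over concatenations. -/
lemma wordSum_append (m n : ℕ) (F : Word N → ℝ) :
    wordSum (m + n) F = wordSum m (fun u => wordSum n (fun v => F (u ++ v))) := by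
  unfold wordSum
  rw [← (Fin.appendEquiv m n).sum_comp, Fintype.sum_prod_type]
  refine Finset.sum_congr rfl fun u _ => Finset.sum_congr rfl fun v _ => ?_
  congr 1
  exact List.ofFn_fin_append u v

/-! ### Almost additive sequences and functions -/

/-- An almost additive sequence stays within bounded distance of a linear one. -/
lemma exists_abs_sub_mul_le {a : ℕ → ℝ} {c : ℝ} (h : ∀ m n, |a (m + n) - a m - a n| ≤ c) :
    ∃ l : ℝ, ∀ n : ℕ, |a n - n * l| ≤ c := by
  -- Fekete's lemma for the subadditive sequence `b + c` gives only a lower bound for `b`; applying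
  -- it to both `a` and `-a` gives the two sides.
  have key : ∀ b : ℕ → ℝ, (∀ m n, |b (m + n) - b m - b n| ≤ c) →
      ∃ l, Tendsto (fun n : ℕ => b n / n) atTop (𝓝 l) ∧ ∀ n : ℕ, n * l ≤ b n + c := by
    intro b hb
    have hc : 0 ≤ c := (abs_nonneg _).trans (hb 0 0)
    have hlow : ∀ n : ℕ, -(n * (c + |b 1|)) - c ≤ b n := by
      intro n
      induction n with
      | zero =>
        have := abs_le.1 (hb 0 0)
        simp at this ⊢
        linarith
      | succ n ih =>
        have := abs_le.1 (hb n 1)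
        have := neg_abs_le (b 1)
        push_cast
        linarith
    have hsub : Subadditive (fun n => b n + c) := fun m n => by
      have := abs_le.1 (hb m n)
      linarith
    have hbdd : BddBelow (Set.range fun n : ℕ => (b n + c) / n) := by
      refine ⟨-(c + |b 1|), ?_⟩
      rintro _ ⟨n, rfl⟩
      rcases Nat.eq_zero_or_pos n with rfl | hn
      · have := abs_nonneg (b 1)
        simp
        linarith
      · have hn' : (0 : ℝ) < n := by exact_mod_cast hn
        dsimp only
        rw [le_div_iff₀ hn']
        linarith [hlow n]
    refine ⟨hsub.lim, ?_, fun n => ?_⟩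
    · have h1 := hsub.tendsto_lim hbdd
      have h2 : Tendsto (fun n : ℕ => c / (n : ℝ)) atTop (𝓝 0) :=
        tendsto_const_div_atTop_nhds_zero_nat c
      simpa [add_div] using h1.sub h2
    · rcases Nat.eq_zero_or_pos n with rfl | hn
      · have := abs_le.1 (hb 0 0)
        simp at this ⊢
        linarith
      · have hn' : (0 : ℝ) < n := by exact_mod_cast hn
        have := hsub.lim_le_div hbdd hn.ne'
        rw [le_div_iff₀ hn'] at this
        linarith
  obtain ⟨l, hl, h1⟩ := key a h
  obtain ⟨l', hl', h2⟩ := key (fun n => -a n) fun m n => by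
    rw [← abs_neg]
    convert h m n using 2
    ring
  have hll : l' = -l := tendsto_nhds_unique hl' (by simpa [neg_div] using hl.neg)
  refine ⟨l, fun n => abs_le.2 ⟨by linarith [h1 n], ?_⟩⟩
  have := h2 n
  rw [hll] at this
  linarith

/-- A function on words is almost additive with constant `c`. -/
def AlmostAdditive (c : ℝ) (g : Word N → ℝ) : Prop :=
  ∀ u v : Word N, |g (u ++ v) - g u - g v| ≤ c

lemma AlmostAdditive.nonneg {c : ℝ} {g : Word N → ℝ} (h : AlmostAdditive c g) : 0 ≤ c :=
  (abs_nonneg _).trans (h [] [])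

lemma AlmostAdditive.sum {ι : Type*} [Fintype ι] {c : ℝ} {f : ι → Word N → ℝ}
    (h : ∀ i, AlmostAdditive c (f i)) (x : ι → ℝ) :
    AlmostAdditive (∑ i, |x i| * c) (fun w => ∑ i, x i * f i w) := by
  intro u v
  rw [← Finset.sum_sub_distrib, ← Finset.sum_sub_distrib]
  refine (Finset.abs_sum_le_sum_abs _ _).trans (Finset.sum_le_sum fun i _ => ?_)
  rw [← mul_sub, ← mul_sub, abs_mul]
  exact mul_le_mul_of_nonneg_left (h i u v) (abs_nonneg _)

/-- An almost additive function grows at most linearly in the length. -/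
lemma AlmostAdditive.exists_abs_le {c : ℝ} {g : Word N → ℝ} (h : AlmostAdditive c g) :
    ∃ M, 0 ≤ M ∧ ∀ w : Word N, |g w| ≤ M * w.length + c := by
  have hc := h.nonneg
  refine ⟨∑ a, |g [a]| + c, by positivity, fun w => ?_⟩
  induction w with
  | nil =>
    have := abs_le.1 (h [] [])
    simp at this ⊢
    exact abs_le.2 ⟨by linarith, by linarith⟩
  | cons a w ih =>
    have h1 := abs_le.1 (h [a] w)
    have h2 := abs_le.1 ih
    have h3 : |g [a]| ≤ ∑ a, |g [a]| :=
      Finset.single_le_sum (f := fun a => |g [a]|) (fun _ _ => abs_nonneg _) (Finset.mem_univ a)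
    have h4 := abs_le.1 h3
    simp only [List.singleton_append] at h1
    simp only [List.length_cons]
    push_cast
    rw [abs_le]
    constructor <;> linarith

/-! ### Partition functions -/

/-- The partition function `∑_{|w| = n} exp (g w)`. -/
def partitionSum (g : Word N → ℝ) (n : ℕ) : ℝ :=
  wordSum n fun w => Real.exp (g w)

lemma partitionSum_pos [NeZero N] (g : Word N → ℝ) (n : ℕ) : 0 < partitionSum g n :=
  wordSum_pos fun _ _ => Real.exp_pos _

lemma AlmostAdditive.exp_append_le {c : ℝ} {g : Word N → ℝ} (h : AlmostAdditive c g)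
    (u v : Word N) :
    Real.exp (g (u ++ v)) ≤ Real.exp c * (Real.exp (g u) * Real.exp (g v)) := by
  rw [← Real.exp_add, ← Real.exp_add, Real.exp_le_exp]
  linarith [(abs_le.1 (h u v)).2]

lemma AlmostAdditive.le_exp_append {c : ℝ} {g : Word N → ℝ} (h : AlmostAdditive c g)
    (u v : Word N) :
    Real.exp (-c) * (Real.exp (g u) * Real.exp (g v)) ≤ Real.exp (g (u ++ v)) := by
  rw [← Real.exp_add, ← Real.exp_add, Real.exp_le_exp]
  linarith [(abs_le.1 (h u v)).1]

lemma wordSum_mul_wordSum (m n : ℕ) (a : ℝ) (F G : Word N → ℝ) :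
    wordSum m (fun u => wordSum n (fun v => a * (F u * G v))) =
      a * (wordSum m F * wordSum n G) := by
  simp only [wordSum_const_mul, wordSum_mul_const]

lemma AlmostAdditive.partitionSum_add_le {c : ℝ} {g : Word N → ℝ} (h : AlmostAdditive c g)
    (m n : ℕ) :
    partitionSum g (m + n) ≤ Real.exp c * (partitionSum g m * partitionSum g n) := by
  unfold partitionSum
  rw [wordSum_append, ← wordSum_mul_wordSum]
  exact wordSum_le_wordSum fun u _ => wordSum_le_wordSum fun v _ => h.exp_append_le u v

lemma AlmostAdditive.le_partitionSum_add {c : ℝ} {g : Word N → ℝ} (h : AlmostAdditive c g)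
    (m n : ℕ) :
    Real.exp (-c) * (partitionSum g m * partitionSum g n) ≤ partitionSum g (m + n) := by
  unfold partitionSum
  rw [wordSum_append, ← wordSum_mul_wordSum]
  exact wordSum_le_wordSum fun u _ => wordSum_le_wordSum fun v _ => h.le_exp_append u v

/-- The partition functions grow exponentially, up to a bounded factor. -/
lemma AlmostAdditive.exists_abs_log_partitionSum_le [NeZero N] {c : ℝ} {g : Word N → ℝ}
    (h : AlmostAdditive c g) :
    ∃ l : ℝ, ∀ n : ℕ, |Real.log (partitionSum g n) - n * l| ≤ c := by
  refine exists_abs_sub_mul_le fun m n => ?_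
  have hm := partitionSum_pos g m
  have hn := partitionSum_pos g n
  have h1 := Real.log_le_log (partitionSum_pos g (m + n)) (h.partitionSum_add_le m n)
  have h2 := Real.log_le_log (by positivity) (h.le_partitionSum_add m n)
  rw [Real.log_mul (by positivity) (by positivity), Real.log_mul (by positivity) (by positivity),
    Real.log_exp] at h1 h2
  exact abs_le.2 ⟨by linarith, by linarith⟩

/-- The pressure of `exp g` is the growth rate of its partition functions. -/
lemma tendsto_logPartition_exp {g : Word N → ℝ} {c l : ℝ}
    (h : ∀ n : ℕ, |Real.log (partitionSum g n) - n * l| ≤ c) :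
    Tendsto (logPartition fun w => Real.exp (g w)) atTop (𝓝 l) := by
  have h0 : Tendsto (fun n : ℕ => c / (n : ℝ)) atTop (𝓝 0) :=
    tendsto_const_div_atTop_nhds_zero_nat c
  rw [tendsto_iff_norm_sub_tendsto_zero]
  refine squeeze_zero' (Eventually.of_forall fun _ => norm_nonneg _) ?_ h0
  filter_upwards [eventually_gt_atTop 0] with n hn
  have hn' : (0 : ℝ) < n := by exact_mod_cast hn
  rw [Real.norm_eq_abs, le_div_iff₀ hn']
  have e : (logPartition (fun w => Real.exp (g w)) n - l) * n =
      Real.log (partitionSum g n) - n * l := by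
    simp only [logPartition, partitionSum, wordSum]
    field_simp
  calc _ = |(logPartition (fun w => Real.exp (g w)) n - l) * n| := by
        rw [abs_mul, Nat.abs_cast]
    _ ≤ c := by
        rw [e]
        exact h n

/-! ### Stationary Gibbs weights -/

/-- The cylinder weights of a shift-invariant probability measure. -/
structure IsStationary (ν : Word N → ℝ) : Prop where
  nonneg : ∀ w, 0 ≤ ν w
  nil : ν [] = 1
  sum_right : ∀ (u : Word N) (n : ℕ), wordSum n (fun v => ν (u ++ v)) = ν u
  sum_left : ∀ (v : Word N) (n : ℕ), wordSum n (fun u => ν (u ++ v)) = ν v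

/-- Eventually bounded families of functions have a pointwise limit along an ultrafilter. -/
lemma exists_tendsto_ultrafilter {α : Type*} (U : Ultrafilter ℕ) (F : ℕ → α → ℝ)
    (lo hi : α → ℝ) (h : ∀ w, ∀ᶠ L in (U : Filter ℕ), F L w ∈ Set.Icc (lo w) (hi w)) :
    ∃ φ : α → ℝ, (∀ w, φ w ∈ Set.Icc (lo w) (hi w)) ∧
      ∀ w, Tendsto (fun L => F L w) U (𝓝 (φ w)) := by
  have (w : α) : ∃ y ∈ Set.Icc (lo w) (hi w), Tendsto (fun L => F L w) U (𝓝 y) :=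
    isCompact_Icc.ultrafilter_le_nhds (U.map fun L => F L w) (by
      rw [le_principal_iff]
      exact h w)
  choose φ hφ hφ' using this
  exact ⟨φ, hφ, hφ'⟩

/-- The relative weight of a word among the words of the same length. -/
def gibbsWeight (g : Word N → ℝ) (w : Word N) : ℝ :=
  Real.exp (g w) / partitionSum g w.length

lemma wordSum_gibbsWeight [NeZero N] (g : Word N → ℝ) (n : ℕ) :
    wordSum n (gibbsWeight g) = 1 := by
  have : wordSum n (gibbsWeight g) = wordSum n fun w => Real.exp (g w) / partitionSum g n :=
    wordSum_congr fun w hw => by rw [gibbsWeight, hw]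
  rw [this, wordSum_div_const]
  exact div_self (partitionSum_pos g n).ne'

lemma gibbsWeight_pos [NeZero N] (g : Word N → ℝ) (w : Word N) : 0 < gibbsWeight g w :=
  div_pos (Real.exp_pos _) (partitionSum_pos g _)

/-- One `c` is lost in splitting `exp g`, the other in splitting the partition function in the
denominator. -/
lemma AlmostAdditive.gibbsWeight_append_le [NeZero N] {c : ℝ} {g : Word N → ℝ} (h : AlmostAdditive c g)
    (u v : Word N) :
    gibbsWeight g (u ++ v) ≤ Real.exp (2 * c) * (gibbsWeight g u * gibbsWeight g v) := by
  have hu := partitionSum_pos g u.length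
  have hv := partitionSum_pos g v.length
  have huv := partitionSum_pos g (u.length + v.length)
  have h1 := h.le_partitionSum_add u.length v.length
  have h2 := h.exp_append_le u v
  rw [gibbsWeight, gibbsWeight, gibbsWeight, List.length_append, div_le_iff₀ huv]
  calc Real.exp (g (u ++ v)) ≤ Real.exp c * (Real.exp (g u) * Real.exp (g v)) := h2
    _ = Real.exp (2 * c) * (Real.exp (g u) / partitionSum g u.length *
          (Real.exp (g v) / partitionSum g v.length)) *
          (Real.exp (-c) * (partitionSum g u.length * partitionSum g v.length)) := by
        rw [two_mul, Real.exp_add, Real.exp_neg]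
        field_simp
    _ ≤ _ := mul_le_mul_of_nonneg_left h1 (by positivity)

lemma AlmostAdditive.le_gibbsWeight_append [NeZero N] {c : ℝ} {g : Word N → ℝ} (h : AlmostAdditive c g)
    (u v : Word N) :
    Real.exp (-(2 * c)) * (gibbsWeight g u * gibbsWeight g v) ≤ gibbsWeight g (u ++ v) := by
  have hu := partitionSum_pos g u.length
  have hv := partitionSum_pos g v.length
  have huv := partitionSum_pos g (u.length + v.length)
  have h1 := h.partitionSum_add_le u.length v.length
  have h2 := h.le_exp_append u v
  rw [gibbsWeight, gibbsWeight, gibbsWeight, List.length_append, le_div_iff₀ huv]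
  calc _ ≤ Real.exp (-(2 * c)) * (Real.exp (g u) / partitionSum g u.length *
          (Real.exp (g v) / partitionSum g v.length)) *
          (Real.exp c * (partitionSum g u.length * partitionSum g v.length)) :=
        mul_le_mul_of_nonneg_left h1 (by positivity)
    _ = Real.exp (-c) * (Real.exp (g u) * Real.exp (g v)) := by
        rw [two_mul, neg_add, Real.exp_add, Real.exp_neg]
        field_simp
    _ ≤ _ := h2

/-- Gibbs weights consistent under extension to the right. -/
lemma AlmostAdditive.exists_right_consistent [NeZero N] {c : ℝ} {g : Word N → ℝ} (h : AlmostAdditive c g) :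
    ∃ ρ : Word N → ℝ, ρ [] = 1 ∧
      (∀ w, Real.exp (-(2 * c)) * gibbsWeight g w ≤ ρ w ∧
        ρ w ≤ Real.exp (2 * c) * gibbsWeight g w) ∧
      ∀ (u : Word N) (n : ℕ), wordSum n (fun v => ρ (u ++ v)) = ρ u := by
  -- For `L ≥ w.length` this is the mass of the words with prefix `w` under the normalised weights
  -- at level `L`. Consistency holds as soon as `L` exceeds the lengths involved, hence in the
  -- ultrafilter limit.
  let F : ℕ → Word N → ℝ := fun L w => wordSum (L - w.length) fun v => gibbsWeight g (w ++ v)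
  have hle : ∀ w : Word N, ∀ᶠ L in ((hyperfilter ℕ : Ultrafilter ℕ) : Filter ℕ), w.length ≤ L :=
    fun w => (Nat.hyperfilter_le_atTop) (eventually_ge_atTop _)
  obtain ⟨ρ, hρ, hlim⟩ := exists_tendsto_ultrafilter (hyperfilter ℕ) F
    (fun w => Real.exp (-(2 * c)) * gibbsWeight g w)
    (fun w => Real.exp (2 * c) * gibbsWeight g w) (fun w => Eventually.of_forall fun L => by
      have hone := wordSum_gibbsWeight g (L - w.length)
      constructor
      · calc _ = wordSum (L - w.length) fun v =>
              Real.exp (-(2 * c)) * (gibbsWeight g w * gibbsWeight g v) := by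
              rw [wordSum_const_mul, wordSum_const_mul, hone, mul_one]
          _ ≤ _ := wordSum_le_wordSum fun v _ => h.le_gibbsWeight_append w v
      · calc _ ≤ wordSum (L - w.length) fun v =>
              Real.exp (2 * c) * (gibbsWeight g w * gibbsWeight g v) :=
              wordSum_le_wordSum fun v _ => h.gibbsWeight_append_le w v
          _ = _ := by rw [wordSum_const_mul, wordSum_const_mul, hone, mul_one])
  refine ⟨ρ, ?_, hρ, fun u n => ?_⟩
  · refine tendsto_nhds_unique (hlim []) (tendsto_const_nhds.congr fun L => ?_)
    simp [F, wordSum_gibbsWeight]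
  · refine tendsto_nhds_unique (tendsto_wordSum (fun v => hlim (u ++ v)) n) ?_
    refine (hlim u).congr' ?_
    filter_upwards [(Nat.hyperfilter_le_atTop) (eventually_ge_atTop (u.length + n))] with L hL
    have hsub : L - u.length = n + (L - (u.length + n)) := by omega
    simp only [F]
    rw [hsub, wordSum_append]
    refine wordSum_congr fun v hv => ?_
    simp [hv]

/-- Shifting a bounded sequence does not change its Cesàro averages asymptotically. -/
lemma tendsto_average_shift_sub {b : ℕ → ℝ} {B : ℝ} (hb : ∀ i, |b i| ≤ B) (m : ℕ) :
    Tendsto (fun L : ℕ => (∑ i ∈ Finset.range L, b (m + i)) / L -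
      (∑ i ∈ Finset.range L, b i) / L) atTop (𝓝 0) := by
  have h0 : Tendsto (fun L : ℕ => (2 * m * B) / (L : ℝ)) atTop (𝓝 0) :=
    tendsto_const_div_atTop_nhds_zero_nat _
  refine squeeze_zero_norm (fun L => ?_) h0
  have hs : ∀ f : ℕ → ℕ, |∑ i ∈ Finset.range m, b (f i)| ≤ m * B := fun f =>
    (Finset.abs_sum_le_sum_abs _ _).trans
      ((Finset.sum_le_sum fun i _ => hb (f i)).trans (by simp))
  have e1 := Finset.sum_range_add b m L
  have e2 := Finset.sum_range_add b L m
  rw [add_comm L m] at e2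
  rw [← sub_div, norm_div, Real.norm_eq_abs, Real.norm_eq_abs, Nat.abs_cast]
  refine div_le_div_of_nonneg_right ?_ (Nat.cast_nonneg L)
  have h1 := abs_le.1 (hs id)
  have h2 := abs_le.1 (hs (L + ·))
  simp only [id] at h1
  rw [abs_le]
  constructor <;> linarith

/-- Existence of a stationary Gibbs state for an almost additive potential. -/
lemma AlmostAdditive.exists_isStationary [NeZero N] {c : ℝ} {g : Word N → ℝ} (h : AlmostAdditive c g) :
    ∃ ν : Word N → ℝ, IsStationary ν ∧
      ∀ w, Real.exp (-(4 * c)) * gibbsWeight g w ≤ ν w ∧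
        ν w ≤ Real.exp (4 * c) * gibbsWeight g w := by
  obtain ⟨ρ, hnil, hρ, hright⟩ := h.exists_right_consistent
  -- `b w i` is the mass that `ρ` gives to the `i`-th shift preimage of the cylinder of `w`. Cesàro
  -- averaging in `i` produces invariance, as in the Krylov–Bogolyubov argument. The constant `4 *
  -- c` is `2 * c` from `ρ` plus `2 * c` from splitting the Gibbs weight of `u ++ w`.
  let b : Word N → ℕ → ℝ := fun w i => wordSum i fun u => ρ (u ++ w)
  have hb : ∀ w i, Real.exp (-(4 * c)) * gibbsWeight g w ≤ b w i ∧
      b w i ≤ Real.exp (4 * c) * gibbsWeight g w := by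
    intro w i
    have hone := wordSum_gibbsWeight g i
    constructor
    · calc _ = wordSum i fun u =>
            gibbsWeight g u * (Real.exp (-(4 * c)) * gibbsWeight g w) := by
            rw [wordSum_mul_const, hone, one_mul]
        _ ≤ _ := wordSum_le_wordSum fun u _ => by
          refine le_trans ?_ (hρ _).1
          refine le_trans (le_of_eq ?_)
            (mul_le_mul_of_nonneg_left (h.le_gibbsWeight_append u w) (Real.exp_pos _).le)
          rw [← mul_assoc (Real.exp _) (Real.exp _), ← Real.exp_add]
          ring_nf
    · calc _ ≤ wordSum i fun u => gibbsWeight g u * (Real.exp (4 * c) * gibbsWeight g w) :=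
            wordSum_le_wordSum fun u _ => by
              refine (hρ _).2.trans ?_
              refine (mul_le_mul_of_nonneg_left (h.gibbsWeight_append_le u w)
                (Real.exp_pos _).le).trans (le_of_eq ?_)
              rw [← mul_assoc, ← Real.exp_add]
              ring_nf
        _ = _ := by rw [wordSum_mul_const, hone, one_mul]
  let F : ℕ → Word N → ℝ := fun L w => (∑ i ∈ Finset.range L, b w i) / L
  have hpos : ∀ᶠ L in ((hyperfilter ℕ : Ultrafilter ℕ) : Filter ℕ), 0 < L :=
    Nat.hyperfilter_le_atTop (eventually_gt_atTop 0)
  obtain ⟨ν, hν, hlim⟩ := exists_tendsto_ultrafilter (hyperfilter ℕ) F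
    (fun w => Real.exp (-(4 * c)) * gibbsWeight g w)
    (fun w => Real.exp (4 * c) * gibbsWeight g w) (fun w => by
      filter_upwards [hpos] with L hL
      have hL' : (0 : ℝ) < L := by exact_mod_cast hL
      simp only [F, Set.mem_Icc]
      rw [le_div_iff₀ hL', div_le_iff₀ hL']
      constructor
      · calc _ = ∑ _i ∈ Finset.range L, Real.exp (-(4 * c)) * gibbsWeight g w := by
              simp [mul_comm]
          _ ≤ _ := Finset.sum_le_sum fun i _ => (hb w i).1
      · calc _ ≤ ∑ _i ∈ Finset.range L, Real.exp (4 * c) * gibbsWeight g w :=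
              Finset.sum_le_sum fun i _ => (hb w i).2
          _ = _ := by simp [mul_comm])
  refine ⟨ν, ⟨fun w => ?_, ?_, fun u n => ?_, fun v m => ?_⟩, hν⟩
  · exact (mul_nonneg (Real.exp_pos _).le (gibbsWeight_pos g w).le).trans (hν w).1
  · refine tendsto_nhds_unique (hlim []) (tendsto_const_nhds.congr' ?_)
    filter_upwards [hpos] with L hL
    have hL' : (L : ℝ) ≠ 0 := by positivity
    have : ∀ i, b [] i = 1 := fun i => by
      simpa [b, hnil] using hright [] i
    simp [F, this, hL']
  · refine tendsto_nhds_unique (tendsto_wordSum (fun v => hlim (u ++ v)) n) ?_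
    refine (hlim u).congr fun L => ?_
    simp only [F, b]
    rw [wordSum_div_const, wordSum_sum]
    congr 1
    refine Finset.sum_congr rfl fun i _ => ?_
    rw [wordSum_comm]
    refine wordSum_congr fun w _ => ?_
    simp only [← List.append_assoc]
    exact (hright (w ++ u) n).symm
  · have hB : ∀ i, |b v i| ≤ Real.exp (4 * c) * gibbsWeight g v := fun i => by
      have h1 : 0 ≤ Real.exp (-(4 * c)) * gibbsWeight g v :=
        mul_nonneg (Real.exp_pos _).le (gibbsWeight_pos g v).le
      rw [abs_of_nonneg (h1.trans (hb v i).1)]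
      exact (hb v i).2
    have h1 := (tendsto_average_shift_sub hB m).mono_left Nat.hyperfilter_le_atTop
    have h2 := h1.add (hlim v)
    rw [zero_add] at h2
    refine tendsto_nhds_unique (tendsto_wordSum (fun u => hlim (u ++ v)) m) (h2.congr fun L => ?_)
    simp only [F, b, sub_add_cancel]
    rw [wordSum_div_const, wordSum_sum]
    congr 1
    refine Finset.sum_congr rfl fun i _ => ?_
    -- Summing over prefixes of length `m` only shifts the time index by `m`, which Cesàro averages
    -- do not see.
    rw [add_comm m i, wordSum_append, wordSum_comm]
    simp only [List.append_assoc]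

/-! ### Means and variances of almost additive functions -/

/-- The mean of `F` over the words of length `n` with weights `ν`. -/
def wordMean (ν : Word N → ℝ) (n : ℕ) (F : Word N → ℝ) : ℝ :=
  wordSum n fun w => ν w * F w

/-- The variance of `F` over the words of length `n` with weights `ν`. -/
def wordVar (ν : Word N → ℝ) (n : ℕ) (F : Word N → ℝ) : ℝ :=
  wordMean ν n fun w => (F w - wordMean ν n F) ^ 2

lemma wordMean_const_mul (ν : Word N → ℝ) (n : ℕ) (a : ℝ) (F : Word N → ℝ) :
    wordMean ν n (fun w => a * F w) = a * wordMean ν n F := by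
  simp only [wordMean, ← wordSum_const_mul]
  exact wordSum_congr fun w _ => by ring

lemma wordMean_add (ν : Word N → ℝ) (n : ℕ) (F G : Word N → ℝ) :
    wordMean ν n (fun w => F w + G w) = wordMean ν n F + wordMean ν n G := by
  simp only [wordMean, ← wordSum_add, mul_add]

lemma wordMean_sub (ν : Word N → ℝ) (n : ℕ) (F G : Word N → ℝ) :
    wordMean ν n (fun w => F w - G w) = wordMean ν n F - wordMean ν n G := by
  simp only [wordMean, ← wordSum_sub, mul_sub]

lemma wordMean_sum {ι : Type*} (ν : Word N → ℝ) (n : ℕ) (s : Finset ι) (F : ι → Word N → ℝ) :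
    wordMean ν n (fun w => ∑ i ∈ s, F i w) = ∑ i ∈ s, wordMean ν n (F i) := by
  simp only [wordMean, ← wordSum_sum, Finset.mul_sum]

namespace IsStationary

variable {ν : Word N → ℝ}

lemma wordSum_eq_one (hν : IsStationary ν) (n : ℕ) : wordSum n ν = 1 := by
  rw [← hν.nil]
  exact hν.sum_right [] n

lemma wordMean_const (hν : IsStationary ν) (n : ℕ) (a : ℝ) : wordMean ν n (fun _ => a) = a := by
  rw [wordMean, wordSum_mul_const, hν.wordSum_eq_one, one_mul]

lemma wordMean_mono (hν : IsStationary ν) {n : ℕ} {F G : Word N → ℝ}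
    (h : ∀ w, w.length = n → F w ≤ G w) : wordMean ν n F ≤ wordMean ν n G :=
  wordSum_le_wordSum fun w hw => mul_le_mul_of_nonneg_left (h w hw) (hν.nonneg w)

lemma abs_wordMean_le (hν : IsStationary ν) {n : ℕ} {F : Word N → ℝ} {B : ℝ}
    (h : ∀ w, w.length = n → |F w| ≤ B) : |wordMean ν n F| ≤ B := by
  rw [abs_le]
  constructor
  · rw [← hν.wordMean_const n (-B)]
    exact hν.wordMean_mono fun w hw => (abs_le.1 (h w hw)).1
  · rw [← hν.wordMean_const n B]
    exact hν.wordMean_mono fun w hw => (abs_le.1 (h w hw)).2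

lemma sum_append_fst (hν : IsStationary ν) (m n : ℕ) (F : Word N → ℝ) :
    wordSum m (fun u => wordSum n fun v => ν (u ++ v) * F u) = wordMean ν m F := by
  simp only [wordSum_mul_const, hν.sum_right, wordMean]

lemma sum_append_snd (hν : IsStationary ν) (m n : ℕ) (F : Word N → ℝ) :
    wordSum m (fun u => wordSum n fun v => ν (u ++ v) * F v) = wordMean ν n F := by
  rw [wordSum_comm]
  simp only [wordSum_mul_const, hν.sum_left, wordMean]

/-- The mean of an almost additive function is linear up to a bounded error. -/
lemma exists_abs_wordMean_sub_le (hν : IsStationary ν) {c : ℝ} {f : Word N → ℝ}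
    (hf : AlmostAdditive c f) : ∃ l : ℝ, ∀ n : ℕ, |wordMean ν n f - n * l| ≤ c := by
  refine exists_abs_sub_mul_le fun m n => ?_
  have e : wordMean ν (m + n) f - wordMean ν m f - wordMean ν n f =
      wordSum m fun u => wordSum n fun v => ν (u ++ v) * (f (u ++ v) - f u - f v) := by
    rw [← hν.sum_append_fst m n f, ← hν.sum_append_snd m n f, wordMean, wordSum_append]
    simp only [← wordSum_sub, mul_sub]
  have hc : wordSum m (fun u => wordSum n fun v => ν (u ++ v) * c) = c := by
    rw [hν.sum_append_fst m n fun _ => c, hν.wordMean_const]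
  have hc' : wordSum m (fun u => wordSum n fun v => ν (u ++ v) * -c) = -c := by
    rw [hν.sum_append_fst m n fun _ => -c, hν.wordMean_const]
  rw [e, abs_le]
  constructor
  · rw [← hc']
    exact wordSum_le_wordSum fun u _ => wordSum_le_wordSum fun v _ =>
      mul_le_mul_of_nonneg_left (abs_le.1 (hf u v)).1 (hν.nonneg _)
  · conv_rhs => rw [← hc]
    exact wordSum_le_wordSum fun u _ => wordSum_le_wordSum fun v _ =>
      mul_le_mul_of_nonneg_left (abs_le.1 (hf u v)).2 (hν.nonneg _)

lemma wordVar_nonneg (hν : IsStationary ν) (n : ℕ) (F : Word N → ℝ) : 0 ≤ wordVar ν n F := by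
  unfold wordVar wordMean
  exact wordSum_nonneg fun _ _ => mul_nonneg (hν.nonneg _) (sq_nonneg _)

lemma wordVar_eq (hν : IsStationary ν) (n : ℕ) (F : Word N → ℝ) :
    wordVar ν n F = wordMean ν n (fun w => F w ^ 2) - wordMean ν n F ^ 2 := by
  have e : (fun w => (F w - wordMean ν n F) ^ 2) =
      fun w => (F w ^ 2 - 2 * wordMean ν n F * F w) + wordMean ν n F ^ 2 := by
    funext w
    ring
  rw [wordVar, e, wordMean_add, wordMean_sub, wordMean_const_mul, hν.wordMean_const]
  ring

/-- Twice the variance is the mean squared difference of two independent copies. -/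
lemma sum_mul_sq_sub (hν : IsStationary ν) (n : ℕ) (F : Word N → ℝ) :
    wordSum n (fun u => wordSum n fun v => ν u * ν v * (F u - F v) ^ 2) =
      2 * wordVar ν n F := by
  have e (u : Word N) : wordSum n (fun v => ν u * ν v * (F u - F v) ^ 2) =
      ν u * ((F u ^ 2 - 2 * wordMean ν n F * F u) + wordMean ν n (fun w => F w ^ 2)) := by
    have e' : (fun v => ν u * ν v * (F u - F v) ^ 2) =
        fun v => ν u * (ν v * ((F u ^ 2 - 2 * F u * F v) + F v ^ 2)) := by
      funext v
      ring
    rw [e', wordSum_const_mul]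
    change ν u * wordMean ν n _ = _
    rw [wordMean_add, wordMean_sub, wordMean_const_mul, hν.wordMean_const]
    ring
  simp only [e]
  change wordMean ν n _ = _
  rw [wordMean_add, wordMean_sub, wordMean_const_mul, hν.wordMean_const, hν.wordVar_eq]
  ring

/-- The parallelogram identity bounds the variance by the loss of second moment under
doubling. -/
lemma wordMean_sq_double_le (hν : IsStationary ν) {κ : ℝ}
    (hκ : ∀ u v, κ * (ν u * ν v) ≤ ν (u ++ v)) {c B : ℝ} {f : Word N → ℝ}
    (hf : AlmostAdditive c f) {n : ℕ} (hB : ∀ w, w.length = n → |f w| ≤ B) :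
    wordMean ν (n + n) (fun w => f w ^ 2) + 2 * κ * wordVar ν n f ≤
      4 * wordMean ν n (fun w => f w ^ 2) + (4 * c * B + c ^ 2) := by
  have hc := hf.nonneg
  -- The lower bound `hκ` compares adjacent blocks with independent ones, for which the mean squared
  -- difference is twice the variance.
  have h1 : κ * (2 * wordVar ν n f) ≤
      wordSum n (fun u => wordSum n fun v => ν (u ++ v) * (f u - f v) ^ 2) := by
    rw [← hν.sum_mul_sq_sub, ← wordSum_const_mul]
    simp only [← wordSum_const_mul]
    refine wordSum_le_wordSum fun u _ => wordSum_le_wordSum fun v _ => ?_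
    rw [← mul_assoc]
    exact mul_le_mul_of_nonneg_right (hκ u v) (sq_nonneg _)
  have h2 : wordMean ν (n + n) (fun w => f w ^ 2) +
      wordSum n (fun u => wordSum n fun v => ν (u ++ v) * (f u - f v) ^ 2) ≤
      wordSum n (fun u => wordSum n fun v => ν (u ++ v) * (2 * f u ^ 2)) +
      wordSum n (fun u => wordSum n fun v => ν (u ++ v) * (2 * f v ^ 2)) +
      wordSum n (fun u => wordSum n fun v => ν (u ++ v) * (4 * c * B + c ^ 2)) := by
    rw [wordMean, wordSum_append]
    simp only [← wordSum_add, ← mul_add]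
    refine wordSum_le_wordSum fun u hu => wordSum_le_wordSum fun v hv =>
      mul_le_mul_of_nonneg_left ?_ (hν.nonneg _)
    have hsum : |f u + f v| ≤ 2 * B :=
      (abs_add_le _ _).trans (by linarith [hB u hu, hB v hv])
    have herr := hf u v
    have hle : |f (u ++ v)| ≤ |f u + f v| + c := by
      have e : f (u ++ v) = (f u + f v) + (f (u ++ v) - f u - f v) := by ring
      rw [e]
      exact (abs_add_le _ _).trans (by linarith)
    have hsq : f (u ++ v) ^ 2 ≤ (|f u + f v| + c) ^ 2 := by
      rw [← sq_abs (f (u ++ v))]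
      exact pow_le_pow_left₀ (abs_nonneg _) hle 2
    have habs := sq_abs (f u + f v)
    nlinarith [mul_le_mul_of_nonneg_left hsum hc]
  rw [hν.sum_append_fst n n fun u => 2 * f u ^ 2, hν.sum_append_snd n n fun u => 2 * f u ^ 2,
    hν.sum_append_fst n n fun _ => 4 * c * B + c ^ 2, hν.wordMean_const,
    wordMean_const_mul] at h2
  linarith

/-- The law of large numbers for stationary weights with a quasi-Bernoulli lower bound, along
powers of two. -/
lemma tendsto_wordVar (hν : IsStationary ν) {κ : ℝ} (hκ0 : 0 < κ)
    (hκ : ∀ u v, κ * (ν u * ν v) ≤ ν (u ++ v)) {c : ℝ} {f : Word N → ℝ}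
    (hf : AlmostAdditive c f) :
    Tendsto (fun k : ℕ => wordVar ν (2 ^ k) f / 4 ^ k) atTop (𝓝 0) := by
  obtain ⟨M, hM0, hM⟩ := hf.exists_abs_le
  have hc := hf.nonneg
  -- The second moment divided by `4 ^ k` decreases under doubling, up to an error of order `2 ^
  -- (-k)`, and the decrease controls the variance. Telescoping makes the normalised variances
  -- summable.
  have hstep (k : ℕ) : wordMean ν (2 ^ (k + 1)) (fun w => f w ^ 2) / 4 ^ (k + 1) +
      κ / 2 * (wordVar ν (2 ^ k) f / 4 ^ k) ≤
      wordMean ν (2 ^ k) (fun w => f w ^ 2) / 4 ^ k +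
        (4 * c * (M + c) + c ^ 2) / 4 * (1 / 2) ^ k := by
    have hB (w : Word N) (hw : w.length = 2 ^ k) : |f w| ≤ (M + c) * 2 ^ k := by
      have h1 := hM w
      have h2 : (1 : ℝ) ≤ 2 ^ k := one_le_pow₀ one_le_two
      rw [hw] at h1
      push_cast at h1
      nlinarith
    have h := hν.wordMean_sq_double_le hκ hf hB
    have e4 : (4 : ℝ) ^ k = 2 ^ k * 2 ^ k := by rw [← mul_pow]; norm_num
    have h2 : (1 : ℝ) ≤ 2 ^ k := one_le_pow₀ one_le_two
    rw [← two_mul, ← pow_succ'] at h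
    have h4 : (0 : ℝ) < 4 * 4 ^ k := by positivity
    have hR : (4 * c * (M + c) + c ^ 2) / 4 * (1 / 2) ^ k =
        (4 * c * ((M + c) * 2 ^ k) + c ^ 2 * 2 ^ k) / (4 * 4 ^ k) := by
      rw [e4, one_div, inv_pow]
      field_simp
    have hL : wordMean ν (2 ^ (k + 1)) (fun w => f w ^ 2) / 4 ^ (k + 1) +
        κ / 2 * (wordVar ν (2 ^ k) f / 4 ^ k) =
        (wordMean ν (2 ^ (k + 1)) (fun w => f w ^ 2) + 2 * κ * wordVar ν (2 ^ k) f) /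
          (4 * 4 ^ k) := by
      rw [pow_succ (4 : ℝ)]
      field_simp
      ring
    have hR' : wordMean ν (2 ^ k) (fun w => f w ^ 2) / 4 ^ k =
        4 * wordMean ν (2 ^ k) (fun w => f w ^ 2) / (4 * 4 ^ k) := by
      field_simp
    rw [hR, hL, hR', ← add_div]
    refine div_le_div_of_nonneg_right (h.trans ?_) h4.le
    nlinarith [sq_nonneg c]
  set C : ℝ := (4 * c * (M + c) + c ^ 2) / 4 with hC
  have hC0 : 0 ≤ C := by positivity
  have hsum (K : ℕ) : ∑ k ∈ Finset.range K, κ / 2 * (wordVar ν (2 ^ k) f / 4 ^ k) ≤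
      wordMean ν 1 (fun w => f w ^ 2) + 2 * C := by
    have hind (K : ℕ) : ∑ k ∈ Finset.range K, κ / 2 * (wordVar ν (2 ^ k) f / 4 ^ k) +
        wordMean ν (2 ^ K) (fun w => f w ^ 2) / 4 ^ K ≤
        wordMean ν 1 (fun w => f w ^ 2) + 2 * C * (1 - (1 / 2) ^ K) := by
      induction K with
      | zero => simp
      | succ K ih =>
        rw [Finset.sum_range_succ, pow_succ (1 / 2 : ℝ)]
        linarith [hstep K]
    have h1 := hind K
    have h2 : 0 ≤ wordMean ν (2 ^ K) (fun w => f w ^ 2) / 4 ^ K :=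
      div_nonneg (wordSum_nonneg fun _ _ => mul_nonneg (hν.nonneg _) (sq_nonneg _))
        (by positivity)
    have h3 : (0 : ℝ) ≤ 2 * C * (1 / 2) ^ K := by positivity
    linarith
  have hs := (summable_of_sum_range_le (fun k => mul_nonneg (by positivity)
    (div_nonneg (hν.wordVar_nonneg (2 ^ k) f) (by positivity))) hsum).tendsto_atTop_zero
  have := hs.const_mul (2 / κ)
  rw [mul_zero] at this
  refine this.congr fun k => ?_
  field_simp

end IsStationary

/-! ### Differentiability of the pressure of almost additive potentials -/

/-- Second-order Taylor bound; only the quadratic order in `y` matters, so the crude factor `exp B`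
is harmless. -/
lemma exp_le_one_add_add_sq {y B : ℝ} (h : |y| ≤ B) :
    Real.exp y ≤ 1 + y + y ^ 2 * Real.exp B := by
  have h1 := Complex.norm_exp_sub_sum_le_norm_mul_exp (y : ℂ) 2
  have e : Complex.exp y - ∑ m ∈ Finset.range 2, (y : ℂ) ^ m / (m.factorial : ℂ) =
      ((Real.exp y - (1 + y) : ℝ) : ℂ) := by
    simp [Finset.sum_range_succ]
  rw [e, Complex.norm_real, Complex.norm_real, Real.norm_eq_abs, Real.norm_eq_abs, sq_abs] at h1
  have h2 : y ^ 2 * Real.exp |y| ≤ y ^ 2 * Real.exp B :=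
    mul_le_mul_of_nonneg_left (Real.exp_le_exp.2 h) (sq_nonneg y)
  linarith [le_abs_self (Real.exp y - (1 + y))]

/-- A remainder bounded by a constant at the scales `2 ^ k`, uniformly on balls of arbitrarily
large rescaled radius, is of smaller order than the identity. -/
lemma isLittleO_of_dyadic_bound {E : Type*} [NormedAddCommGroup E] {Δ : E → ℝ} {K : ℝ}
    (hK : 0 < K) (h0 : Δ 0 = 0)
    (h : ∀ s > 0, ∃ k₀ : ℕ, ∀ k ≥ k₀, ∀ y : E, 2 ^ k * ‖y‖ ≤ s → 2 ^ k * |Δ y| ≤ K) :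
    Δ =o[𝓝 0] (fun y => y) := by
  rw [Asymptotics.isLittleO_iff]
  intro ε hε
  -- With `2 ^ k ≤ s / ‖y‖ < 2 ^ (k + 1)`, the bound `K / 2 ^ k` is below `2 * K * ‖y‖ / s = ε *
  -- ‖y‖`.
  set s := 2 * K / ε with hs
  have hs0 : 0 < s := by positivity
  obtain ⟨k₀, hk₀⟩ := h s hs0
  have hball : Metric.ball (0 : E) (s / 2 ^ (k₀ + 1)) ∈ 𝓝 (0 : E) :=
    Metric.ball_mem_nhds _ (by positivity)
  filter_upwards [hball] with y hy
  rcases eq_or_ne y 0 with rfl | hy0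
  · simp [h0]
  have hy' : 0 < ‖y‖ := norm_pos_iff.2 hy0
  rw [mem_ball_zero_iff, lt_div_iff₀ (by positivity), mul_comm, ← lt_div_iff₀ hy'] at hy
  have h1 : (1 : ℝ) ≤ s / ‖y‖ := (one_le_pow₀ one_le_two).trans hy.le
  obtain ⟨k, hk1, hk2⟩ := exists_nat_pow_near h1 (one_lt_two (α := ℝ))
  have hkk : k₀ + 1 < k + 1 := (pow_lt_pow_iff_right₀ (one_lt_two (α := ℝ))).1 (hy.trans hk2)
  have h2 := hk₀ k (by omega) y (by rwa [← le_div_iff₀ hy'])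
  rw [div_lt_iff₀ hy', hs, div_lt_iff₀ hε, pow_succ] at hk2
  rw [Real.norm_eq_abs]
  have h3 : (0 : ℝ) < 2 ^ k := by positivity
  refine le_of_mul_le_mul_left ?_ h3
  nlinarith

namespace IsStationary

variable {ν : Word N → ℝ}

/-- Jensen's inequality. -/
lemma exp_wordMean_le (hν : IsStationary ν) (n : ℕ) (G : Word N → ℝ) :
    Real.exp (wordMean ν n G) ≤ wordMean ν n (fun w => Real.exp (G w)) := by
  have h1 : wordMean ν n (fun w => Real.exp (wordMean ν n G) *
      ((G w - wordMean ν n G) + 1)) = Real.exp (wordMean ν n G) := by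
    rw [wordMean_const_mul, wordMean_add, wordMean_sub, hν.wordMean_const, hν.wordMean_const]
    ring
  conv_lhs => rw [← h1]
  refine hν.wordMean_mono fun w _ => ?_
  calc _ ≤ Real.exp (wordMean ν n G) * Real.exp (G w - wordMean ν n G) :=
        mul_le_mul_of_nonneg_left (Real.add_one_le_exp _) (Real.exp_pos _).le
    _ = _ := by rw [← Real.exp_add]; ring_nf

/-- Expanding the exponential about the mean of `G` removes the linear term and leaves the variance.
This is the upper counterpart of Jensen's inequality. -/
lemma wordMean_exp_le (hν : IsStationary ν) {n : ℕ} {G : Word N → ℝ} {B : ℝ}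
    (hB : ∀ w, w.length = n → |G w - wordMean ν n G| ≤ B) :
    wordMean ν n (fun w => Real.exp (G w)) ≤
      Real.exp (wordMean ν n G) * (1 + Real.exp B * wordVar ν n G) := by
  have h1 : wordMean ν n (fun w => Real.exp (wordMean ν n G) *
      ((1 + (G w - wordMean ν n G)) + Real.exp B * (G w - wordMean ν n G) ^ 2)) =
      Real.exp (wordMean ν n G) * (1 + Real.exp B * wordVar ν n G) := by
    rw [wordMean_const_mul, wordMean_add, wordMean_add, wordMean_sub, wordMean_const_mul,
      hν.wordMean_const, hν.wordMean_const, wordVar]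
    ring
  rw [← h1]
  refine hν.wordMean_mono fun w hw => ?_
  calc Real.exp (G w) = Real.exp (wordMean ν n G) * Real.exp (G w - wordMean ν n G) := by
        rw [← Real.exp_add]; ring_nf
    _ ≤ _ := mul_le_mul_of_nonneg_left
        ((exp_le_one_add_add_sq (hB w hw)).trans (by linarith)) (Real.exp_pos _).le

lemma abs_log_wordMean_exp_sub_le (hν : IsStationary ν) {n : ℕ} {G : Word N → ℝ} {B : ℝ}
    (hB : ∀ w, w.length = n → |G w - wordMean ν n G| ≤ B) :
    |Real.log (wordMean ν n fun w => Real.exp (G w)) - wordMean ν n G| ≤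
      Real.exp B * wordVar ν n G := by
  have h1 := hν.exp_wordMean_le n G
  have h2 := hν.wordMean_exp_le hB
  have h3 := Real.log_le_log (Real.exp_pos _) h1
  have h4 := Real.log_le_log ((Real.exp_pos _).trans_le h1) h2
  have hV : 0 ≤ Real.exp B * wordVar ν n G :=
    mul_nonneg (Real.exp_pos _).le (hν.wordVar_nonneg n G)
  have h5 := Real.log_le_sub_one_of_pos (show 0 < 1 + Real.exp B * wordVar ν n G by linarith)
  rw [Real.log_mul (Real.exp_pos _).ne' (by linarith), Real.log_exp] at h4
  rw [Real.log_exp] at h3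
  exact abs_le.2 ⟨by linarith, by linarith⟩

lemma sum_mul_sub_wordMean {ι : Type*} [Fintype ι] (n : ℕ) (f : ι → Word N → ℝ) (y : ι → ℝ)
    (w : Word N) :
    ∑ i, y i * f i w - wordMean ν n (fun w => ∑ i, y i * f i w) =
      ∑ i, y i * (f i w - wordMean ν n (f i)) := by
  rw [wordMean_sum]
  simp only [wordMean_const_mul, ← Finset.sum_sub_distrib, mul_sub]

/-- Cauchy–Schwarz, with the supremum norm on `ι → ℝ`. -/
lemma wordVar_sum_le {ι : Type*} [Fintype ι] (hν : IsStationary ν) (n : ℕ)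
    (f : ι → Word N → ℝ) (y : ι → ℝ) :
    wordVar ν n (fun w => ∑ i, y i * f i w) ≤
      Fintype.card ι * ‖y‖ ^ 2 * ∑ i, wordVar ν n (f i) := by
  simp only [wordVar, sum_mul_sub_wordMean]
  rw [← wordMean_sum, ← wordMean_const_mul]
  refine hν.wordMean_mono fun w _ => ?_
  refine (sq_sum_le_card_mul_sum_sq).trans ?_
  rw [Finset.card_univ, mul_assoc]
  refine mul_le_mul_of_nonneg_left ?_ (Nat.cast_nonneg _)
  rw [Finset.mul_sum]
  refine Finset.sum_le_sum fun i _ => ?_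
  rw [mul_pow]
  refine mul_le_mul_of_nonneg_right ?_ (sq_nonneg _)
  rw [← sq_abs (y i)]
  exact pow_le_pow_left₀ (abs_nonneg _) (norm_le_pi_norm y i) 2

end IsStationary

/-- The quotient of the two partition functions is exactly the mean of `exp G` under the normalised
Gibbs weights; passing to `ν` costs a factor between `exp (-K)` and `exp K`. -/
lemma log_partitionSum_add_sub_le [NeZero N] {g G ν : Word N → ℝ} (hν : IsStationary ν) {K : ℝ}
    (hgν : ∀ w, Real.exp (-K) * gibbsWeight g w ≤ ν w ∧ ν w ≤ Real.exp K * gibbsWeight g w)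
    (n : ℕ) :
    |Real.log (partitionSum (fun w => g w + G w) n) - Real.log (partitionSum g n) -
      Real.log (wordMean ν n fun w => Real.exp (G w))| ≤ K := by
  have hZ := partitionSum_pos g n
  have hZ' := partitionSum_pos (fun w => g w + G w) n
  have hA : 0 < wordMean ν n fun w => Real.exp (G w) :=
    (Real.exp_pos _).trans_le (hν.exp_wordMean_le n G)
  have e : partitionSum (fun w => g w + G w) n =
      partitionSum g n * wordSum n fun w => gibbsWeight g w * Real.exp (G w) := by
    rw [← wordSum_const_mul, partitionSum]
    refine wordSum_congr fun w hw => ?_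
    rw [gibbsWeight, hw, Real.exp_add]
    field_simp
  have hS : 0 < wordSum n fun w => gibbsWeight g w * Real.exp (G w) :=
    wordSum_pos fun w _ => mul_pos (gibbsWeight_pos g w) (Real.exp_pos _)
  have h1 : Real.exp (-K) * wordSum n (fun w => gibbsWeight g w * Real.exp (G w)) ≤
      wordMean ν n fun w => Real.exp (G w) := by
    rw [← wordSum_const_mul]
    refine wordSum_le_wordSum fun w _ => ?_
    rw [← mul_assoc]
    exact mul_le_mul_of_nonneg_right (hgν w).1 (Real.exp_pos _).le
  have h2 : wordMean ν n (fun w => Real.exp (G w)) ≤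
      Real.exp K * wordSum n (fun w => gibbsWeight g w * Real.exp (G w)) := by
    rw [← wordSum_const_mul]
    refine wordSum_le_wordSum fun w _ => ?_
    rw [← mul_assoc]
    exact mul_le_mul_of_nonneg_right (hgν w).2 (Real.exp_pos _).le
  have h3 := Real.log_le_log (by positivity) h1
  have h4 := Real.log_le_log hA h2
  rw [Real.log_mul (Real.exp_pos _).ne' hS.ne', Real.log_exp] at h3 h4
  rw [e, Real.log_mul hZ.ne' hS.ne']
  exact abs_le.2 ⟨by linarith, by linarith⟩

/-- The pressure of linear combinations of almost additive potentials is a differentiable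
function of the coefficients. -/
theorem differentiable_of_abs_log_partitionSum_le [NeZero N] {ι : Type*} [Fintype ι]
    {f : ι → Word N → ℝ} {c : ℝ} (hf : ∀ i, AlmostAdditive c (f i)) {Q : (ι → ℝ) → ℝ}
    (hQ : ∀ x (n : ℕ), |Real.log (partitionSum (fun w => ∑ i, x i * f i w) n) - n * Q x| ≤
      ∑ i, |x i| * c) :
    Differentiable ℝ Q := by
  intro x
  rcases isEmpty_or_nonempty ι with hι | ⟨⟨i₀⟩⟩
  · exact (hasFDerivAt_of_subsingleton Q x).differentiableAt
  have hc : 0 ≤ c := (hf i₀).nonneg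
  have hg := AlmostAdditive.sum hf x
  set g : Word N → ℝ := fun w => ∑ i, x i * f i w with hgdef
  set c₀ : ℝ := ∑ i, |x i| * c with hc₀def
  have hc₀ : 0 ≤ c₀ := by positivity
  obtain ⟨ν, hν, hgν⟩ := hg.exists_isStationary
  -- `14 = 4 + 4 + 4 + 2`: three comparisons of `ν` with `gibbsWeight` and one splitting of a Gibbs
  -- weight.
  have hκ (u v : Word N) : Real.exp (-(14 * c₀)) * (ν u * ν v) ≤ ν (u ++ v) := by
    calc _ ≤ Real.exp (-(14 * c₀)) * ((Real.exp (4 * c₀) * gibbsWeight g u) *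
          (Real.exp (4 * c₀) * gibbsWeight g v)) :=
          mul_le_mul_of_nonneg_left (mul_le_mul (hgν u).2 (hgν v).2 (hν.nonneg v)
            (mul_nonneg (Real.exp_pos _).le (gibbsWeight_pos g u).le)) (Real.exp_pos _).le
      _ = Real.exp (-(14 * c₀)) * (Real.exp (4 * c₀) * Real.exp (4 * c₀)) *
          (gibbsWeight g u * gibbsWeight g v) := by ring
      _ = Real.exp (-(4 * c₀)) * (Real.exp (-(2 * c₀)) *
          (gibbsWeight g u * gibbsWeight g v)) := by
          have e : Real.exp (-(14 * c₀)) * (Real.exp (4 * c₀) * Real.exp (4 * c₀)) =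
              Real.exp (-(4 * c₀)) * Real.exp (-(2 * c₀)) := by
            simp only [← Real.exp_add]
            ring_nf
          rw [e, mul_assoc]
      _ ≤ Real.exp (-(4 * c₀)) * gibbsWeight g (u ++ v) :=
          mul_le_mul_of_nonneg_left (hg.le_gibbsWeight_append u v) (Real.exp_pos _).le
      _ ≤ _ := (hgν _).1
  choose l hl using fun i => hν.exists_abs_wordMean_sub_le (hf i)
  choose M hM0 hM using fun i => (hf i).exists_abs_le
  let D : (ι → ℝ) →L[ℝ] ℝ := ∑ i, l i • ContinuousLinearMap.proj i
  have hD (y : ι → ℝ) : D y = ∑ i, y i * l i := by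
    simp [D, mul_comm]
  refine (HasFDerivAt.differentiableAt (f' := D) ?_)
  rw [hasFDerivAt_iff_isLittleO_nhds_zero]
  have hlim : Tendsto (fun k : ℕ => ∑ i, wordVar ν (2 ^ k) (f i) / 4 ^ k) atTop (𝓝 0) := by
    simpa using tendsto_finsetSum (Finset.univ : Finset ι) fun i _ =>
      hν.tendsto_wordVar (Real.exp_pos _) hκ (hf i)
  set d : ℝ := (Fintype.card ι : ℝ) with hd
  -- The terms of `K`: `4 * c₀` from replacing Gibbs weights by `ν`, `c₀` from `hQ x`, `c₀ + d * c`
  -- from `hQ (x + y)`, `d * c` from the mean, `1` from the variance. None depends on `s`.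
  refine isLittleO_of_dyadic_bound (K := 6 * c₀ + 2 * (d * c) + 1) (by positivity) (by simp)
    fun s hs => ?_
  set B : ℝ := ∑ i, s * (2 * (M i + c)) with hBdef
  have hlim' := hlim.const_mul (Real.exp B * (d * s ^ 2))
  rw [mul_zero] at hlim'
  obtain ⟨k₁, hk₁⟩ := eventually_atTop.1 (hlim'.eventually (ge_mem_nhds one_pos))
  obtain ⟨k₂, hk₂⟩ := pow_unbounded_of_one_lt s (one_lt_two (α := ℝ))
  -- `k₁` makes the variance term at most `1`, even with the factor `exp B` depending on `s`; `k₂`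
  -- forces `‖y‖ ≤ 1`.
  refine ⟨max k₁ k₂, fun k hk y hy => ?_⟩
  have hpow : (1 : ℝ) ≤ 2 ^ k := one_le_pow₀ one_le_two
  have hy1 : ‖y‖ ≤ 1 := by
    have h1 : (2 : ℝ) ^ k₂ ≤ 2 ^ k :=
      pow_le_pow_right₀ one_le_two (le_trans (le_max_right _ _) hk)
    by_contra! hlt
    nlinarith
  set G : Word N → ℝ := fun w => ∑ i, y i * f i w with hGdef
  have hGB (w : Word N) (hw : w.length = 2 ^ k) : |G w - wordMean ν (2 ^ k) G| ≤ B := by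
    rw [hGdef, IsStationary.sum_mul_sub_wordMean]
    refine (Finset.abs_sum_le_sum_abs _ _).trans (Finset.sum_le_sum fun i _ => ?_)
    have h1 (w : Word N) (hw : w.length = 2 ^ k) : |f i w| ≤ (M i + c) * 2 ^ k := by
      have h2 := hM i w
      rw [hw] at h2
      push_cast at h2
      nlinarith
    have h2 : |f i w - wordMean ν (2 ^ k) (f i)| ≤ 2 * (M i + c) * 2 ^ k :=
      (abs_sub _ _).trans (by linarith [h1 w hw, hν.abs_wordMean_le h1])
    have h3 : |y i| ≤ ‖y‖ := norm_le_pi_norm y i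
    have hMi : 0 ≤ 2 * (M i + c) := by linarith [hM0 i]
    rw [abs_mul]
    calc _ ≤ ‖y‖ * (2 * (M i + c) * 2 ^ k) :=
          mul_le_mul h3 h2 (abs_nonneg _) (norm_nonneg _)
      _ = (2 ^ k * ‖y‖) * (2 * (M i + c)) := by ring
      _ ≤ _ := mul_le_mul_of_nonneg_right hy hMi
  have hVar : Real.exp B * wordVar ν (2 ^ k) G ≤ 1 := by
    have h1 := hν.wordVar_sum_le (2 ^ k) f y
    refine le_trans ?_ (hk₁ k (le_trans (le_max_left _ _) hk))
    rw [mul_assoc]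
    refine mul_le_mul_of_nonneg_left (h1.trans ?_) (Real.exp_pos _).le
    have h4 : (4 : ℝ) ^ k = 2 ^ k * 2 ^ k := by rw [← mul_pow]; norm_num
    have h5 : 0 ≤ ∑ i, wordVar ν (2 ^ k) (f i) / 4 ^ k :=
      Finset.sum_nonneg fun i _ => div_nonneg (hν.wordVar_nonneg _ _) (by positivity)
    calc _ = d * (2 ^ k * ‖y‖) ^ 2 * ∑ i, wordVar ν (2 ^ k) (f i) / 4 ^ k := by
          rw [← Finset.sum_div, h4, hd]
          field_simp
      _ ≤ _ := mul_le_mul_of_nonneg_right (mul_le_mul_of_nonneg_left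
          (pow_le_pow_left₀ (by positivity) hy 2) (Nat.cast_nonneg _)) h5
  have hMean : |wordMean ν (2 ^ k) G - 2 ^ k * D y| ≤ d * c := by
    rw [hD, hGdef, wordMean_sum, Finset.mul_sum, ← Finset.sum_sub_distrib]
    refine (Finset.abs_sum_le_sum_abs _ _).trans ?_
    calc _ ≤ ∑ _i : ι, c := Finset.sum_le_sum fun i _ => by
          have h1 := hl i (2 ^ k)
          push_cast at h1
          have h3 : |y i| ≤ 1 := (norm_le_pi_norm y i).trans hy1
          rw [wordMean_const_mul, mul_left_comm, ← mul_sub, abs_mul]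
          nlinarith [abs_nonneg (y i), abs_nonneg (wordMean ν (2 ^ k) (f i) - 2 ^ k * l i)]
      _ = d * c := by simp [hd]
  have h1 := hν.abs_log_wordMean_exp_sub_le hGB
  have h2 := log_partitionSum_add_sub_le (G := G) hν hgν (2 ^ k)
  have h3 := hQ x (2 ^ k)
  have h4 := hQ (x + y) (2 ^ k)
  have h5 : ∑ i, |(x + y) i| * c ≤ c₀ + d * c := by
    calc _ ≤ ∑ i, (|x i| * c + c) := Finset.sum_le_sum fun i _ => by
          have h3 : |y i| ≤ 1 := (norm_le_pi_norm y i).trans hy1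
          have := abs_add_le (x i) (y i)
          rw [Pi.add_apply]
          nlinarith
      _ = _ := by rw [Finset.sum_add_distrib]; simp [hd, hc₀def]
  have e : (fun w => ∑ i, (x + y) i * f i w) = fun w => g w + G w := by
    funext w
    simp [hgdef, hGdef, add_mul, Finset.sum_add_distrib]
  rw [e] at h4
  push_cast at h3 h4
  have e2 : (2 : ℝ) ^ k * |Q (x + y) - Q x - D y| = |2 ^ k * (Q (x + y) - Q x - D y)| := by
    rw [abs_mul, abs_of_pos (by positivity : (0 : ℝ) < 2 ^ k)]
  rw [e2]
  rw [abs_le] at *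
  constructor <;> linarith

/-! ### Norms of `2 × 2` matrices -/

/-- The area form on the Euclidean plane. -/
def planeArea (p q : EuclideanSpace ℝ (Fin 2)) : ℝ := p 0 * q 1 - p 1 * q 0

lemma sq_norm_mul_norm (p q : EuclideanSpace ℝ (Fin 2)) :
    (‖p‖ * ‖q‖) ^ 2 = inner ℝ p q ^ 2 + planeArea p q ^ 2 := by
  rw [mul_pow, EuclideanSpace.real_norm_sq_eq, EuclideanSpace.real_norm_sq_eq, planeArea,
    PiLp.inner_apply]
  simp [Fin.sum_univ_two]
  ring

lemma abs_planeArea_le (p q : EuclideanSpace ℝ (Fin 2)) : |planeArea p q| ≤ ‖p‖ * ‖q‖ := by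
  refine abs_le_of_sq_le_sq ?_ (by positivity)
  rw [sq_norm_mul_norm]
  linarith [sq_nonneg (inner ℝ p q)]

lemma planeArea_map (M : Matrix (Fin 2) (Fin 2) ℝ) (p q : EuclideanSpace ℝ (Fin 2)) :
    planeArea (Matrix.toEuclideanCLM (n := Fin 2) (𝕜 := ℝ) M p)
      (Matrix.toEuclideanCLM (n := Fin 2) (𝕜 := ℝ) M q) = M.det * planeArea p q := by
  simp [planeArea, Matrix.det_fin_two, Matrix.mulVec, dotProduct, Fin.sum_univ_two]
  ring

/-- A linear map of the plane acts on two vectors spanning a small area by almost proportional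
factors. -/
lemma norm_mul_norm_map_le {F : Type*} [NormedAddCommGroup F] [NormedSpace ℝ F]
    (T : EuclideanSpace ℝ (Fin 2) →L[ℝ] F) (p q : EuclideanSpace ℝ (Fin 2)) :
    ‖p‖ * ‖T q‖ ≤ ‖q‖ * ‖T p‖ + 2 * ‖T‖ * |planeArea p q| := by
  have hL := sq_norm_mul_norm p q
  have hP : 0 ≤ ‖p‖ * ‖q‖ := by positivity
  have key : ∀ e : ℝ, e ^ 2 = 1 → 0 ≤ e * inner ℝ p q →
      ‖p‖ * ‖T q‖ ≤ ‖q‖ * ‖T p‖ + 2 * ‖T‖ * |planeArea p q| := by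
    intro e he hpos
    have he1 : |e| = 1 := by
      rw [← sq_abs] at he
      nlinarith [abs_nonneg e]
    -- With `e` the sign of the inner product, `p` and `e • q` make an angle of at most a right
    -- angle, so `z` is controlled by the area.
    set z := ‖p‖ • q - (e * ‖q‖) • p with hz
    have hzn : ‖z‖ ^ 2 = 2 * (‖p‖ * ‖q‖) * (‖p‖ * ‖q‖ - e * inner ℝ p q) := by
      rw [hz, @norm_sub_sq_real, norm_smul, norm_smul, inner_smul_left, inner_smul_right,
        real_inner_comm]
      simp only [Real.norm_eq_abs, abs_mul, abs_norm, he1, conj_trivial]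
      ring
    have hI : (e * inner ℝ p q) ^ 2 = inner ℝ p q ^ 2 := by rw [mul_pow, he, one_mul]
    have hIP : e * inner ℝ p q ≤ ‖p‖ * ‖q‖ := by
      refine le_of_sq_le_sq ?_ hP
      rw [hI, hL]
      linarith [sq_nonneg (planeArea p q)]
    have hz2 : ‖z‖ ≤ 2 * |planeArea p q| := by
      refine le_of_sq_le_sq ?_ (by positivity)
      rw [hzn, mul_pow, sq_abs]
      nlinarith [sq_nonneg (planeArea p q)]
    have hT : ‖p‖ • T q = T z + (e * ‖q‖) • T p := by
      rw [hz, map_sub, map_smul, map_smul]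
      abel
    calc ‖p‖ * ‖T q‖ = ‖‖p‖ • T q‖ := by rw [norm_smul, norm_norm]
      _ ≤ ‖T z‖ + ‖(e * ‖q‖) • T p‖ := by rw [hT]; exact norm_add_le _ _
      _ ≤ ‖T‖ * (2 * |planeArea p q|) + ‖q‖ * ‖T p‖ := by
          refine add_le_add ((T.le_opNorm z).trans
            (mul_le_mul_of_nonneg_left hz2 (norm_nonneg _))) (le_of_eq ?_)
          rw [norm_smul, Real.norm_eq_abs, abs_mul, he1, abs_norm, one_mul]
      _ = _ := by ring
  rcases le_total 0 (inner ℝ p q : ℝ) with h | h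
  · exact key 1 (by norm_num) (by simpa using h)
  · exact key (-1) (by norm_num) (by linarith)

lemma euclideanOpNorm_nonneg (M : Matrix (Fin 2) (Fin 2) ℝ) : 0 ≤ euclideanOpNorm M :=
  norm_nonneg _

lemma euclideanOpNorm_mul_le (M M' : Matrix (Fin 2) (Fin 2) ℝ) :
    euclideanOpNorm (M * M') ≤ euclideanOpNorm M * euclideanOpNorm M' := by
  unfold euclideanOpNorm
  rw [map_mul]
  exact norm_mul_le _ _

lemma euclideanOpNorm_one : euclideanOpNorm 1 = 1 := by
  unfold euclideanOpNorm
  rw [map_one]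
  exact norm_one

lemma euclideanOpNorm_smul (a : ℝ) (M : Matrix (Fin 2) (Fin 2) ℝ) :
    euclideanOpNorm (a • M) = |a| * euclideanOpNorm M := by
  unfold euclideanOpNorm
  rw [map_smul, norm_smul, Real.norm_eq_abs]

open scoped Matrix.Norms.L2Operator in
lemma euclideanOpNorm_transpose (M : Matrix (Fin 2) (Fin 2) ℝ) :
    euclideanOpNorm M.transpose = euclideanOpNorm M := by
  have := Matrix.l2_opNorm_conjTranspose M
  rwa [Matrix.conjTranspose_eq_transpose_of_trivial] at this

-- In the plane the adjugate is the transpose conjugated by a quarter turn. Hence `‖g⁻¹‖ = ‖g‖ /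
-- |det g|`.
open scoped Matrix.Norms.L2Operator in
lemma euclideanOpNorm_adjugate_le (M : Matrix (Fin 2) (Fin 2) ℝ) :
    euclideanOpNorm M.adjugate ≤ euclideanOpNorm M := by
  set J : Matrix (Fin 2) (Fin 2) ℝ := !![0, -1; 1, 0] with hJ
  have h1 : euclideanOpNorm J * euclideanOpNorm J = 1 := by
    have h := Matrix.l2_opNorm_conjTranspose_mul_self J
    have e : J.conjTranspose * J = 1 := by
      ext i j
      fin_cases i <;> fin_cases j <;> simp [hJ, Matrix.mul_apply, Fin.sum_univ_two]
    rw [e] at h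
    exact h.symm.trans euclideanOpNorm_one
  have h2 : M.adjugate = J.transpose * M.transpose * J := by
    ext i j
    fin_cases i <;> fin_cases j <;>
      simp [hJ, Matrix.mul_apply, Fin.sum_univ_two, Matrix.adjugate_fin_two]
  rw [h2]
  calc _ ≤ euclideanOpNorm J.transpose * euclideanOpNorm M.transpose * euclideanOpNorm J :=
        (euclideanOpNorm_mul_le _ _).trans (mul_le_mul_of_nonneg_right
          (euclideanOpNorm_mul_le _ _) (euclideanOpNorm_nonneg _))
    _ = euclideanOpNorm J * euclideanOpNorm J * euclideanOpNorm M := by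
        rw [euclideanOpNorm_transpose, euclideanOpNorm_transpose]
        ring
    _ = _ := by rw [h1, one_mul]

lemma euclideanOpNorm_adjugate (M : Matrix (Fin 2) (Fin 2) ℝ) :
    euclideanOpNorm M.adjugate = euclideanOpNorm M := by
  refine le_antisymm (euclideanOpNorm_adjugate_le M) ?_
  have := euclideanOpNorm_adjugate_le M.adjugate
  rwa [Matrix.adjugate_adjugate _ (by simp), Fintype.card_fin, Nat.sub_self, pow_zero,
    one_smul] at this

lemma abs_det_pos (g : GL (Fin 2) ℝ) : 0 < |(g : Matrix (Fin 2) (Fin 2) ℝ).det| := by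
  have := (Matrix.isUnit_iff_isUnit_det _).1 g.isUnit
  exact abs_pos.2 this.ne_zero

lemma euclideanOpNorm_inv (g : GL (Fin 2) ℝ) :
    euclideanOpNorm ((g⁻¹ : GL (Fin 2) ℝ) : Matrix (Fin 2) (Fin 2) ℝ) =
      euclideanOpNorm (g : Matrix (Fin 2) (Fin 2) ℝ) /
        |(g : Matrix (Fin 2) (Fin 2) ℝ).det| := by
  rw [Matrix.coe_units_inv, Matrix.inv_def, euclideanOpNorm_smul, euclideanOpNorm_adjugate,
    Ring.inverse_eq_inv', abs_inv]
  ring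

/-- If `M` strongly contracts one direction, then `A * M` and `M` have almost the same expanding
direction. -/
lemma euclideanOpNorm_mul_mul_le (A M V : Matrix (Fin 2) (Fin 2) ℝ) :
    euclideanOpNorm (M * V) * euclideanOpNorm (A * M) ≤
      euclideanOpNorm M * euclideanOpNorm (A * M * V) +
        2 * euclideanOpNorm A * |M.det| * euclideanOpNorm V := by
  unfold euclideanOpNorm
  set Φ := Matrix.toEuclideanCLM (n := Fin 2) (𝕜 := ℝ) with hΦ
  -- The images `M x` and `M y` span an area at most `|det M| ‖x‖ ‖y‖`. Passing to operator norms in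
  -- `y`, then putting `x = V z` and doing the same in `z`, gives the claim.
  have h1 (x y : EuclideanSpace ℝ (Fin 2)) : ‖Φ M x‖ * ‖Φ (A * M) y‖ ≤
      (‖Φ M‖ * ‖Φ (A * M) x‖ + 2 * ‖Φ A‖ * |M.det| * ‖x‖) * ‖y‖ := by
    have h := norm_mul_norm_map_le (Φ A) (Φ M x) (Φ M y)
    rw [hΦ, planeArea_map, ← hΦ, abs_mul] at h
    have e (z : EuclideanSpace ℝ (Fin 2)) : Φ A (Φ M z) = Φ (A * M) z := by
      rw [map_mul]
      rfl
    rw [e, e] at h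
    refine h.trans ?_
    have h2 := mul_le_mul_of_nonneg_right ((Φ M).le_opNorm y) (norm_nonneg (Φ (A * M) x))
    have h3 := mul_le_mul_of_nonneg_left (abs_planeArea_le x y)
      (by positivity : 0 ≤ 2 * ‖Φ A‖ * |M.det|)
    linarith
  have h2 (x : EuclideanSpace ℝ (Fin 2)) : ‖Φ M x‖ * ‖Φ (A * M)‖ ≤
      ‖Φ M‖ * ‖Φ (A * M) x‖ + 2 * ‖Φ A‖ * |M.det| * ‖x‖ := by
    have h := ContinuousLinearMap.opNorm_le_bound (‖Φ M x‖ • Φ (A * M))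
      (by positivity : 0 ≤ ‖Φ M‖ * ‖Φ (A * M) x‖ + 2 * ‖Φ A‖ * |M.det| * ‖x‖) (fun y => by
        rw [smul_apply, norm_smul, norm_norm]
        exact h1 x y)
    rwa [norm_smul, norm_norm] at h
  have h := ContinuousLinearMap.opNorm_le_bound (‖Φ (A * M)‖ • Φ (M * V))
    (by positivity : 0 ≤ ‖Φ M‖ * ‖Φ (A * M * V)‖ + 2 * ‖Φ A‖ * |M.det| * ‖Φ V‖) (fun z => by
      rw [smul_apply, norm_smul, norm_norm, mul_comm]
      have e : Φ (M * V) z = Φ M (Φ V z) := by rw [map_mul]; rfl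
      have e' : Φ (A * M * V) z = Φ (A * M) (Φ V z) := by rw [map_mul]; rfl
      have h3 := h2 (Φ V z)
      have h4 := mul_le_mul_of_nonneg_left ((Φ (A * M * V)).le_opNorm z) (norm_nonneg (Φ M))
      have h5 := mul_le_mul_of_nonneg_left ((Φ V).le_opNorm z)
        (by positivity : 0 ≤ 2 * ‖Φ A‖ * |M.det|)
      rw [e'] at h4
      rw [e]
      linarith)
  rw [norm_smul, norm_norm] at h
  linarith

lemma euclideanOpNorm_mul_mul_le' (U M B : Matrix (Fin 2) (Fin 2) ℝ) :
    euclideanOpNorm (U * M) * euclideanOpNorm (M * B) ≤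
      euclideanOpNorm M * euclideanOpNorm (U * M * B) +
        2 * euclideanOpNorm B * |M.det| * euclideanOpNorm U := by
  have h := euclideanOpNorm_mul_mul_le B.transpose M.transpose U.transpose
  simp only [← Matrix.transpose_mul, euclideanOpNorm_transpose, Matrix.det_transpose,
    ← mul_assoc] at h
  exact h

/-! ### Dominated tuples have almost multiplicative norms -/

/-- `|det A_w|`. -/
def wordDet (A : Fin N → GL (Fin 2) ℝ) (w : Word N) : ℝ :=
  |(wordProd A w : Matrix (Fin 2) (Fin 2) ℝ).det|

/-- The ratio `α₂ / α₁` of the singular values. -/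
def singularRatio (A : Fin N → GL (Fin 2) ℝ) (w : Word N) : ℝ :=
  wordDet A w / alphaOne A w ^ 2

/-- The ratio `‖A_u A_v‖ / (‖A_u‖ ‖A_v‖)`. -/
def normDefect (A : Fin N → GL (Fin 2) ℝ) (u v : Word N) : ℝ :=
  alphaOne A (u ++ v) / (alphaOne A u * alphaOne A v)

lemma wordProd_append (A : Fin N → GL (Fin 2) ℝ) (u v : Word N) :
    wordProd A (u ++ v) = wordProd A u * wordProd A v := by
  simp [wordProd]

lemma coe_wordProd_append (A : Fin N → GL (Fin 2) ℝ) (u v : Word N) :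
    (wordProd A (u ++ v) : Matrix (Fin 2) (Fin 2) ℝ) = wordProd A u * wordProd A v := by
  rw [wordProd_append]
  rfl

lemma wordDet_pos (A : Fin N → GL (Fin 2) ℝ) (w : Word N) : 0 < wordDet A w :=
  abs_det_pos _

lemma wordDet_append (A : Fin N → GL (Fin 2) ℝ) (u v : Word N) :
    wordDet A (u ++ v) = wordDet A u * wordDet A v := by
  rw [wordDet, coe_wordProd_append, Matrix.det_mul, abs_mul]
  rfl

lemma alphaOne_pos (A : Fin N → GL (Fin 2) ℝ) (w : Word N) : 0 < alphaOne A w := by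
  have h := euclideanOpNorm_mul_le (wordProd A w : Matrix (Fin 2) (Fin 2) ℝ)
    ((wordProd A w)⁻¹ : GL (Fin 2) ℝ)
  rw [Units.mul_inv, euclideanOpNorm_one] at h
  refine lt_of_le_of_ne (euclideanOpNorm_nonneg _) fun h0 => ?_
  rw [alphaOne] at h0
  rw [← h0, zero_mul] at h
  linarith

lemma alphaOne_append_le (A : Fin N → GL (Fin 2) ℝ) (u v : Word N) :
    alphaOne A (u ++ v) ≤ alphaOne A u * alphaOne A v := by
  rw [alphaOne, coe_wordProd_append]
  exact euclideanOpNorm_mul_le _ _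

lemma alphaTwo_eq (A : Fin N → GL (Fin 2) ℝ) (w : Word N) :
    alphaTwo A w = wordDet A w / alphaOne A w := by
  rw [alphaTwo, euclideanOpNorm_inv, inv_div]
  rfl

lemma singularRatio_pos (A : Fin N → GL (Fin 2) ℝ) (w : Word N) : 0 < singularRatio A w :=
  div_pos (wordDet_pos A w) (pow_pos (alphaOne_pos A w) 2)

lemma singularRatio_nil (A : Fin N → GL (Fin 2) ℝ) : singularRatio A [] = 1 := by
  simp [singularRatio, wordDet, alphaOne, wordProd, euclideanOpNorm_one]

lemma normDefect_pos (A : Fin N → GL (Fin 2) ℝ) (u v : Word N) : 0 < normDefect A u v :=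
  div_pos (alphaOne_pos A _) (mul_pos (alphaOne_pos A u) (alphaOne_pos A v))

lemma singularRatio_append (A : Fin N → GL (Fin 2) ℝ) (u v : Word N) :
    singularRatio A (u ++ v) * normDefect A u v ^ 2 = singularRatio A u * singularRatio A v := by
  have h1 := alphaOne_pos A u
  have h2 := alphaOne_pos A v
  have h3 := alphaOne_pos A (u ++ v)
  rw [singularRatio, singularRatio, singularRatio, normDefect, wordDet_append]
  field_simp

lemma normDefect_le_one (A : Fin N → GL (Fin 2) ℝ) (u v : Word N) : normDefect A u v ≤ 1 :=
  div_le_one_of_le₀ (alphaOne_append_le A u v)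
    (mul_pos (alphaOne_pos A u) (alphaOne_pos A v)).le

lemma singularRatio_mul_le (A : Fin N → GL (Fin 2) ℝ) (u v : Word N) :
    singularRatio A u * singularRatio A v ≤ singularRatio A (u ++ v) := by
  rw [← singularRatio_append]
  exact mul_le_of_le_one_right (singularRatio_pos A _).le
    (pow_le_one₀ (normDefect_pos A u v).le (normDefect_le_one A u v))

/-- This is `‖A_v‖ ≤ ‖A_u⁻¹‖ ‖A_u A_v‖` with the norm of the inverse written through the
determinant. -/
lemma singularRatio_le_normDefect_left (A : Fin N → GL (Fin 2) ℝ) (u v : Word N) :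
    singularRatio A u ≤ normDefect A u v := by
  have h1 := alphaOne_pos A u
  have h2 := alphaOne_pos A v
  have hd := wordDet_pos A u
  have h := euclideanOpNorm_mul_le ((wordProd A u)⁻¹ : GL (Fin 2) ℝ)
    (wordProd A (u ++ v) : Matrix (Fin 2) (Fin 2) ℝ)
  rw [coe_wordProd_append, ← mul_assoc, Units.inv_mul, one_mul, euclideanOpNorm_inv,
    ← coe_wordProd_append] at h
  change alphaOne A v ≤ alphaOne A u / wordDet A u * alphaOne A (u ++ v) at h
  rw [div_mul_eq_mul_div, le_div_iff₀ hd] at h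
  rw [singularRatio, normDefect, div_le_div_iff₀ (by positivity) (by positivity)]
  nlinarith

lemma singularRatio_le_normDefect_right (A : Fin N → GL (Fin 2) ℝ) (u v : Word N) :
    singularRatio A v ≤ normDefect A u v := by
  have h1 := alphaOne_pos A u
  have h2 := alphaOne_pos A v
  have hd := wordDet_pos A v
  have h := euclideanOpNorm_mul_le (wordProd A (u ++ v) : Matrix (Fin 2) (Fin 2) ℝ)
    ((wordProd A v)⁻¹ : GL (Fin 2) ℝ)
  rw [coe_wordProd_append, mul_assoc, Units.mul_inv, mul_one, euclideanOpNorm_inv,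
    ← coe_wordProd_append] at h
  change alphaOne A u ≤ alphaOne A (u ++ v) * (alphaOne A v / wordDet A v) at h
  rw [mul_div_assoc', le_div_iff₀ hd] at h
  rw [singularRatio, normDefect, div_le_div_iff₀ (by positivity) (by positivity)]
  nlinarith

/-- Deleting the outer letter `a` raises the defect ratio by at most a multiple of `singularRatio A
u`, because `A_u` and `A_a A_u` expand nearly the same direction. The hypothesis on `K` bounds
`‖A_a‖ ‖A_u‖` by `K ‖A_a A_u‖`. -/
lemma normDefect_le_cons (A : Fin N → GL (Fin 2) ℝ) {K : ℝ}
    (hK : ∀ a, 1 ≤ K * singularRatio A [a]) (a : Fin N) (u v : Word N) :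
    normDefect A u v ≤ normDefect A (a :: u) v + 2 * K * singularRatio A u := by
  have h1 := alphaOne_pos A u
  have h2 := alphaOne_pos A v
  have h3 := alphaOne_pos A [a]
  have h4 := alphaOne_pos A (a :: u)
  have hd := wordDet_pos A u
  have h := euclideanOpNorm_mul_mul_le (wordProd A [a]) (wordProd A u) (wordProd A v)
  rw [← coe_wordProd_append, ← coe_wordProd_append, ← coe_wordProd_append] at h
  change alphaOne A (u ++ v) * alphaOne A (a :: u) ≤ alphaOne A u * alphaOne A (a :: u ++ v) +
    2 * alphaOne A [a] * wordDet A u * alphaOne A v at h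
  have h5 : alphaOne A [a] * alphaOne A u ≤ K * alphaOne A (a :: u) := by
    have h6 := (le_div_iff₀ (by positivity)).1 (singularRatio_le_normDefect_left A [a] u)
    have hK0 : 0 ≤ K := by
      by_contra! hneg
      have := hK a
      nlinarith [singularRatio_pos A [a]]
    have h7 := mul_le_mul_of_nonneg_left h6 hK0
    have h8 := mul_le_mul_of_nonneg_right (hK a) (by positivity :
      0 ≤ alphaOne A [a] * alphaOne A u)
    rw [List.singleton_append] at h7
    linarith
  have e1 : normDefect A u v = alphaOne A (u ++ v) * alphaOne A (a :: u) /
      (alphaOne A u * alphaOne A v * alphaOne A (a :: u)) := by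
    rw [normDefect]
    field_simp
  have e2 : normDefect A (a :: u) v + 2 * K * singularRatio A u =
      (alphaOne A u * alphaOne A (a :: u ++ v) +
        2 * (K * alphaOne A (a :: u) / alphaOne A u) * wordDet A u * alphaOne A v) /
      (alphaOne A u * alphaOne A v * alphaOne A (a :: u)) := by
    rw [normDefect, singularRatio]
    field_simp
  rw [e1, e2]
  refine div_le_div_of_nonneg_right (h.trans ?_) (by positivity)
  have h9 := (le_div_iff₀ h1).2 h5
  gcongr

lemma normDefect_le_concat (A : Fin N → GL (Fin 2) ℝ) {K : ℝ}
    (hK : ∀ a, 1 ≤ K * singularRatio A [a]) (a : Fin N) (u v : Word N) :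
    normDefect A u v ≤ normDefect A u (v ++ [a]) + 2 * K * singularRatio A v := by
  have h1 := alphaOne_pos A u
  have h2 := alphaOne_pos A v
  have h3 := alphaOne_pos A [a]
  have h4 := alphaOne_pos A (v ++ [a])
  have hd := wordDet_pos A v
  have h := euclideanOpNorm_mul_mul_le' (wordProd A u) (wordProd A v) (wordProd A [a])
  rw [← coe_wordProd_append, ← coe_wordProd_append, ← coe_wordProd_append] at h
  change alphaOne A (u ++ v) * alphaOne A (v ++ [a]) ≤ alphaOne A v *
    alphaOne A (u ++ v ++ [a]) + 2 * alphaOne A [a] * wordDet A v * alphaOne A u at h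
  rw [List.append_assoc] at h
  have h5 : alphaOne A [a] * alphaOne A v ≤ K * alphaOne A (v ++ [a]) := by
    have h6 := (le_div_iff₀ (by positivity)).1 (singularRatio_le_normDefect_right A v [a])
    have hK0 : 0 ≤ K := by
      by_contra! hneg
      have := hK a
      nlinarith [singularRatio_pos A [a]]
    have h7 := mul_le_mul_of_nonneg_left h6 hK0
    have h8 := mul_le_mul_of_nonneg_right (hK a) (by positivity :
      0 ≤ alphaOne A [a] * alphaOne A v)
    linarith
  have e1 : normDefect A u v = alphaOne A (u ++ v) * alphaOne A (v ++ [a]) /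
      (alphaOne A u * alphaOne A v * alphaOne A (v ++ [a])) := by
    rw [normDefect]
    field_simp
  have e2 : normDefect A u (v ++ [a]) + 2 * K * singularRatio A v =
      (alphaOne A v * alphaOne A (u ++ (v ++ [a])) +
        2 * (K * alphaOne A (v ++ [a]) / alphaOne A v) * wordDet A v * alphaOne A u) /
      (alphaOne A u * alphaOne A v * alphaOne A (v ++ [a])) := by
    rw [normDefect, singularRatio]
    field_simp
  rw [e1, e2]
  refine div_le_div_of_nonneg_right (h.trans ?_) (by positivity)
  have h9 := (le_div_iff₀ h2).2 h5
  gcongr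

/-- Stopping a word at the longest suffix on which `r` is at least `K⁻¹ ^ L`. -/
lemma exists_suffix_stopping {r d : Word N → ℝ} {K K' C τ : ℝ} (hK : 1 ≤ K) (hK' : 0 ≤ K')
    (hC : 0 ≤ C) (hτ : 0 ≤ τ) (hnil : r [] = 1) (hr : ∀ a w, r w ≤ K * r (a :: w))
    (hd : ∀ a w, d w ≤ d (a :: w) + K' * r w) (hdom : ∀ w, r w ≤ C * τ ^ w.length) (L : ℕ)
    (w : Word N) (hw : r w < K⁻¹ ^ L) :
    ∃ w' : Word N, K⁻¹ ^ L ≤ r w' ∧ L ≤ w'.length ∧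
      d w' ≤ d w + K' * ∑ k ∈ Finset.range w.length, min (K * K⁻¹ ^ L) (C * τ ^ k) := by
  have hK0 : 0 < K := one_pos.trans_le hK
  have hKi : K⁻¹ ≤ 1 := inv_le_one_of_one_le₀ hK
  have hlow (w : Word N) : K⁻¹ ^ w.length ≤ r w := by
    induction w with
    | nil => simp [hnil]
    | cons a w ih =>
      rw [List.length_cons, pow_succ, mul_inv_le_iff₀ hK0, mul_comm]
      exact ih.trans (hr a w)
  induction w with
  | nil =>
    rw [hnil] at hw
    exact absurd hw (not_lt.2 (pow_le_one₀ (by positivity) hKi))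
  | cons a w ih =>
    have hmin : 0 ≤ min (K * K⁻¹ ^ L) (C * τ ^ w.length) := le_min (by positivity) (by positivity)
    rw [List.length_cons, Finset.sum_range_succ, mul_add]
    rcases lt_or_ge (r w) (K⁻¹ ^ L) with h | h
    · obtain ⟨w', h1, h2, h3⟩ := ih h
      refine ⟨w', h1, h2, h3.trans ?_⟩
      have h4 : r w ≤ min (K * K⁻¹ ^ L) (C * τ ^ w.length) :=
        le_min (h.le.trans (le_mul_of_one_le_left (by positivity) hK)) (hdom w)
      have := hd a w
      have := mul_le_mul_of_nonneg_left h4 hK'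
      linarith
    · refine ⟨w, h, ?_, ?_⟩
      · have h1 := (hlow (a :: w)).trans_lt hw
        by_contra! hlt
        rw [List.length_cons] at h1
        exact absurd h1 (not_lt.2 (pow_le_pow_of_le_one (by positivity) hKi hlt))
      -- At the stopping time `r w` may exceed `K⁻¹ ^ L`, but only by one letter's factor `K`; hence
      -- the `K` inside the minimum.
      · have h4 : r w ≤ min (K * K⁻¹ ^ L) (C * τ ^ w.length) :=
          le_min ((hr a w).trans (mul_le_mul_of_nonneg_left hw.le hK0.le)) (hdom w)
        have h5 := mul_le_mul_of_nonneg_left h4 hK'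
        have h6 : 0 ≤ K' * ∑ k ∈ Finset.range w.length, min (K * K⁻¹ ^ L) (C * τ ^ k) :=
          mul_nonneg hK' (Finset.sum_nonneg fun k _ => le_min (by positivity) (by positivity))
        linarith [hd a w]

/-- Split at `k = p * L`, beyond which `τ ^ k ≤ K⁻¹ ^ L` and the tail is geometric. The total cost
of the deletions is then `K⁻¹ ^ L` times a factor linear in `L`, independently of the word length.
-/
lemma sum_min_le {K C τ : ℝ} (hK : 0 < K) (hC : 0 ≤ C) (hτ : 0 < τ) (hτ1 : τ < 1) {p : ℕ}
    (hp : τ ^ p ≤ K⁻¹) (L n : ℕ) :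
    ∑ k ∈ Finset.range n, min (K * K⁻¹ ^ L) (C * τ ^ k) ≤
      K⁻¹ ^ L * (p * L * K + C / (1 - τ)) := by
  have h1τ : 0 < 1 - τ := by linarith
  have ht : τ ^ (p * L) ≤ K⁻¹ ^ L := by
    rw [pow_mul]
    exact pow_le_pow_left₀ (by positivity) hp L
  calc _ ≤ ∑ k ∈ Finset.range (p * L + n), min (K * K⁻¹ ^ L) (C * τ ^ k) :=
        Finset.sum_le_sum_of_subset_of_nonneg
          (Finset.range_subset_range.2 (Nat.le_add_left _ _))
          fun k _ _ => le_min (by positivity) (by positivity)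
    _ = ∑ k ∈ Finset.range (p * L), min (K * K⁻¹ ^ L) (C * τ ^ k) +
          ∑ k ∈ Finset.range n, min (K * K⁻¹ ^ L) (C * τ ^ (p * L + k)) :=
        Finset.sum_range_add _ _ _
    _ ≤ ∑ k ∈ Finset.range (p * L), K * K⁻¹ ^ L +
          ∑ k ∈ Finset.range n, C * K⁻¹ ^ L * τ ^ k :=
        add_le_add (Finset.sum_le_sum fun k _ => min_le_left _ _)
          (Finset.sum_le_sum fun k _ => (min_le_right _ _).trans (by
            rw [pow_add, ← mul_assoc]
            gcongr))
    _ ≤ p * L * (K * K⁻¹ ^ L) + C * K⁻¹ ^ L * (1 / (1 - τ)) := by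
        rw [Finset.sum_const, Finset.card_range, nsmul_eq_mul, Nat.cast_mul, ← Finset.mul_sum]
        refine add_le_add le_rfl (mul_le_mul_of_nonneg_left ?_ (by positivity))
        rw [le_div_iff₀ h1τ, mul_comm, mul_neg_geom_sum]
        linarith [pow_pos hτ n]
    _ = _ := by ring

/-- For a dominated tuple the norm is almost multiplicative. -/
theorem IsDominated.exists_mul_alphaOne_le {A : Fin N → GL (Fin 2) ℝ} (hA : IsDominated A) :
    ∃ κ : ℝ, 0 < κ ∧ ∀ u v : Word N,
      κ * (alphaOne A u * alphaOne A v) ≤ alphaOne A (u ++ v) := by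
  obtain ⟨C, τ, hC, hτ, hτ1, hdom⟩ := hA
  have hdom' (w : Word N) : singularRatio A w ≤ C * τ ^ w.length := by
    have h1 := alphaOne_pos A w
    have h2 := hdom w
    rw [alphaTwo_eq, div_le_iff₀ h1] at h2
    rw [singularRatio, div_le_iff₀ (by positivity)]
    linarith
  set K : ℝ := 1 + ∑ a, 1 / singularRatio A [a] with hKdef
  have hpos (a : Fin N) : 0 ≤ 1 / singularRatio A [a] := (one_div_pos.2 (singularRatio_pos A _)).le
  have hK1 : 1 ≤ K := le_add_of_nonneg_right (Finset.sum_nonneg fun a _ => hpos a)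
  have hK0 : 0 < K := one_pos.trans_le hK1
  have hK (a : Fin N) : 1 ≤ K * singularRatio A [a] := by
    rw [← div_le_iff₀ (singularRatio_pos A _)]
    have := Finset.single_le_sum (fun a _ => hpos a) (Finset.mem_univ a)
    linarith
  clear_value K
  obtain ⟨p, hp⟩ := exists_pow_lt_of_lt_one (inv_pos.2 hK0) hτ1
  set b : ℝ := 1 + 4 * K * (C / (1 - τ)) with hb
  have hlim : Tendsto (fun L : ℕ => C * (b * τ ^ L + 4 * K * (p * K) * (L * τ ^ L)) ^ 2)
      atTop (𝓝 0) := by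
    have h1 := tendsto_pow_atTop_nhds_zero_of_lt_one hτ.le hτ1
    have h2 := tendsto_self_mul_const_pow_of_lt_one hτ.le hτ1
    simpa using (((h1.const_mul b).add (h2.const_mul (4 * K * (p * K)))).pow 2).const_mul C
  -- The shortened words lose only a factor linear in `L`, whereas domination of their product gains
  -- `τ ^ (2 * L)`; a large `L` makes the gain win.
  obtain ⟨L, hL⟩ := (hlim.eventually (gt_mem_nhds one_pos)).exists
  set t : ℝ := K⁻¹ ^ L with ht
  have ht0 : 0 < t := by positivity
  refine ⟨t, ht0, fun u v => ?_⟩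
  suffices t ≤ normDefect A u v from
    (le_div_iff₀ (mul_pos (alphaOne_pos A u) (alphaOne_pos A v))).1 this
  by_contra! hlt
  have hu := (singularRatio_le_normDefect_left A u v).trans_lt hlt
  have hv := (singularRatio_le_normDefect_right A u v).trans_lt hlt
  have hcons (a : Fin N) (w : Word N) : singularRatio A w ≤ K * singularRatio A (a :: w) := by
    have h1 : singularRatio A [a] * singularRatio A w ≤ singularRatio A (a :: w) :=
      singularRatio_mul_le A [a] w
    have h2 := mul_le_mul_of_nonneg_right (hK a) (singularRatio_pos A w).le
    have h3 := mul_le_mul_of_nonneg_left h1 hK0.le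
    linarith
  have hconcat (a : Fin N) (w : Word N) :
      singularRatio A w.reverse ≤ K * singularRatio A (a :: w).reverse := by
    rw [List.reverse_cons]
    have h1 := singularRatio_mul_le A w.reverse [a]
    have h2 := mul_le_mul_of_nonneg_right (hK a) (singularRatio_pos A w.reverse).le
    have h3 := mul_le_mul_of_nonneg_left h1 hK0.le
    linarith
  obtain ⟨u', hu1, hu2, hu3⟩ := exists_suffix_stopping (r := singularRatio A)
    (d := fun w => normDefect A w v) (K' := 2 * K) hK1 (by positivity) hC.le hτ.le
    (singularRatio_nil A) hcons (fun a w => normDefect_le_cons A hK a w v) hdom' L u hu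
  have hdconcat (a : Fin N) (w : Word N) : normDefect A u' w.reverse ≤
      normDefect A u' (a :: w).reverse + 2 * K * singularRatio A w.reverse := by
    rw [List.reverse_cons]
    exact normDefect_le_concat A hK a u' w.reverse
  -- Reversal turns deletion at the end of `v` into deletion at the front, so the same stopping
  -- lemma applies with `u'` already fixed.
  obtain ⟨v', hv1, hv2, hv3⟩ := exists_suffix_stopping (r := fun w => singularRatio A w.reverse)
    (d := fun w => normDefect A u' w.reverse) (K' := 2 * K) hK1 (by positivity) hC.le hτ.le
    (by simpa only [List.reverse_nil] using singularRatio_nil A) hconcat hdconcat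
    (fun w => (hdom' w.reverse).trans_eq (by rw [List.length_reverse])) L v.reverse
    (by simpa only [List.reverse_reverse] using hv)
  have hsu := sum_min_le hK0 hC.le hτ hτ1 hp.le L u.length
  have hsv := sum_min_le hK0 hC.le hτ hτ1 hp.le L v.reverse.length
  simp only [List.reverse_reverse] at hv3
  have h2K : 0 ≤ 2 * K := by positivity
  have hdef : normDefect A u' v'.reverse ≤ t * (b + 4 * K * (p * K) * L) := by
    have h1 := mul_le_mul_of_nonneg_left hsu h2K
    have h2 := mul_le_mul_of_nonneg_left hsv h2K
    rw [hb]
    linarith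
  have hlen : singularRatio A (u' ++ v'.reverse) ≤ C * (τ ^ L) ^ 2 := by
    refine (hdom' _).trans (mul_le_mul_of_nonneg_left ?_ hC.le)
    rw [← pow_mul]
    refine pow_le_pow_of_le_one hτ.le hτ1.le ?_
    simp
    omega
  have hprod := singularRatio_append A u' v'.reverse
  have h1 : t * t ≤ singularRatio A u' * singularRatio A v'.reverse :=
    mul_le_mul hu1 hv1 ht0.le (singularRatio_pos A u').le
  have h2 : singularRatio A (u' ++ v'.reverse) * normDefect A u' v'.reverse ^ 2 ≤
      C * (τ ^ L) ^ 2 * (t * (b + 4 * K * (p * K) * L)) ^ 2 :=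
    mul_le_mul hlen (pow_le_pow_left₀ (normDefect_pos A _ _).le hdef 2) (sq_nonneg _)
      (by positivity)
  -- Both shortened ratios are at least `t`, and `singularRatio_append` bounds their product from
  -- above; this contradicts the choice of `L`.
  have h3 : t * t ≤ t * t * (C * (b * τ ^ L + 4 * K * (p * K) * (L * τ ^ L)) ^ 2) := by
    rw [← hprod] at h1
    refine (h1.trans h2).trans (le_of_eq ?_)
    ring
  have h4 : 0 < t * t := by positivity
  have := mul_lt_mul_of_pos_left hL h4
  linarith

/-! ### The potentials `ψ^{q,s}` -/

lemma almostAdditive_log {θ : Word N → ℝ} {a b : ℝ} (ha : 0 < a) (hb : 0 < b)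
    (hθ : ∀ w, 0 < θ w) (hlow : ∀ u v, a * (θ u * θ v) ≤ θ (u ++ v))
    (hup : ∀ u v, θ (u ++ v) ≤ b * (θ u * θ v)) :
    AlmostAdditive (max (-Real.log a) (Real.log b)) fun w => Real.log (θ w) := by
  intro u v
  have hu := hθ u
  have hv := hθ v
  have h1 := Real.log_le_log (by positivity) (hlow u v)
  have h2 := Real.log_le_log (hθ _) (hup u v)
  rw [Real.log_mul (by positivity) (by positivity), Real.log_mul hu.ne' hv.ne'] at h1 h2
  have h3 := le_max_left (-Real.log a) (Real.log b)
  have h4 := le_max_right (-Real.log a) (Real.log b)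
  exact abs_le.2 ⟨by linarith, by linarith⟩

lemma AlmostAdditive.mono {c c' : ℝ} {g : Word N → ℝ} (h : AlmostAdditive c g) (hc : c ≤ c') :
    AlmostAdditive c' g :=
  fun u v => (h u v).trans hc

lemma IsQuasiBernoulli.real_pos {μ : Measure (Shift N)} [IsProbabilityMeasure μ]
    (hμ : IsQuasiBernoulli μ) (w : Word N) : 0 < μ.real (wordCylinder w) :=
  ENNReal.toReal_pos (hμ.1 w).ne' (measure_ne_top _ _)

lemma IsQuasiBernoulli.exists_almostAdditive {μ : Measure (Shift N)} [IsProbabilityMeasure μ]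
    (hμ : IsQuasiBernoulli μ) :
    ∃ c, AlmostAdditive c fun w => Real.log (μ.real (wordCylinder w)) := by
  obtain ⟨C, hC, hsub, hsup⟩ := hμ.2
  have hC0 : 0 < C := one_pos.trans_le hC
  refine ⟨_, almostAdditive_log (inv_pos.2 hC0) hC0 hμ.real_pos (fun u v => ?_) fun u v => ?_⟩
  · have hu := hμ.real_pos u
    have hv := hμ.real_pos v
    have huv := hμ.real_pos (u ++ v)
    have h := hsup u v
    simp only [one_div, mul_inv, inv_inv] at h
    -- Super-multiplicativity is stated for reciprocals; this factor clears all denominators.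
    calc _ = C * (μ.real (wordCylinder (u ++ v)))⁻¹ * (C⁻¹ ^ 2 * (μ.real (wordCylinder u) *
          μ.real (wordCylinder v)) * μ.real (wordCylinder (u ++ v))) := by field_simp
      _ ≤ C * (μ.real (wordCylinder u))⁻¹ * (C * (μ.real (wordCylinder v))⁻¹) *
          (C⁻¹ ^ 2 * (μ.real (wordCylinder u) * μ.real (wordCylinder v)) *
            μ.real (wordCylinder (u ++ v))) := mul_le_mul_of_nonneg_right h (by positivity)
      _ = _ := by field_simp
  · have h := hsub u v
    have h1 := mul_le_mul_of_nonneg_left h (inv_pos.2 hC0).le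
    field_simp at h1
    linarith

lemma IsDominated.exists_almostAdditive {A : Fin N → GL (Fin 2) ℝ} (hA : IsDominated A) :
    ∃ c, AlmostAdditive c fun w => Real.log (alphaOne A w) := by
  obtain ⟨κ, hκ, h⟩ := hA.exists_mul_alphaOne_le
  exact ⟨_, almostAdditive_log hκ one_pos (alphaOne_pos A) h fun u v => by
    rw [one_mul]
    exact alphaOne_append_le A u v⟩

lemma almostAdditive_log_wordDet (A : Fin N → GL (Fin 2) ℝ) :
    AlmostAdditive 0 fun w => Real.log (wordDet A w) := by
  intro u v
  dsimp only
  rw [wordDet_append, Real.log_mul (wordDet_pos A u).ne' (wordDet_pos A v).ne']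
  simp

/-- The exponent of `α₁` in `φ^s`, written as a product of powers of `α₁` and `|det|`. -/
def normExponent (s : ℝ) : ℝ := if s < 1 then s else if s < 2 then 2 - s else 0

/-- The exponent of `|det|` in `φ^s`, written as a product of powers of `α₁` and `|det|`. -/
def detExponent (s : ℝ) : ℝ := if s < 1 then 0 else if s < 2 then s - 1 else s / 2

lemma singularValueFunction_eq_exp (A : Fin N → GL (Fin 2) ℝ) (s : ℝ) (w : Word N) :
    singularValueFunction A s w = Real.exp (normExponent s * Real.log (alphaOne A w) +
      detExponent s * Real.log (wordDet A w)) := by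
  have h1 := alphaOne_pos A w
  have h2 := wordDet_pos A w
  unfold singularValueFunction normExponent detExponent
  split_ifs
  · rw [Real.rpow_def_of_pos h1]
    ring_nf
  · rw [alphaTwo_eq, Real.rpow_def_of_pos (div_pos h2 h1), Real.log_div h2.ne' h1.ne']
    nth_rewrite 1 [← Real.exp_log h1]
    rw [← Real.exp_add]
    ring_nf
  · change wordDet A w ^ (s / 2) = _
    rw [Real.rpow_def_of_pos h2]
    ring_nf

/-- The logarithms of `μ([w])`, `α₁` and `|det|`. -/
def basePotential (A : Fin N → GL (Fin 2) ℝ) (μ : Measure (Shift N)) : Fin 3 → Word N → ℝ :=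
  ![fun w => Real.log (μ.real (wordCylinder w)), fun w => Real.log (alphaOne A w),
    fun w => Real.log (wordDet A w)]

/-- The coefficients of `log ψ^{q,s}` with respect to `basePotential`. -/
def psiCoeff (p : ℝ × ℝ) : Fin 3 → ℝ :=
  ![p.1, (1 - p.1) * normExponent p.2, (1 - p.1) * detExponent p.2]

lemma psi_eq_exp (A : Fin N → GL (Fin 2) ℝ) {μ : Measure (Shift N)} [IsProbabilityMeasure μ]
    (hμ : IsQuasiBernoulli μ) (q s : ℝ) :
    psi A μ q s = fun w => Real.exp (∑ i, psiCoeff (q, s) i * basePotential A μ i w) := by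
  funext w
  rw [psi, singularValueFunction_eq_exp, Real.rpow_def_of_pos (hμ.real_pos w), ← Real.exp_mul,
    ← Real.exp_add]
  simp only [Fin.sum_univ_three, psiCoeff, basePotential, Matrix.cons_val]
  ring_nf

lemma exists_almostAdditive_basePotential {A : Fin N → GL (Fin 2) ℝ} (hA : IsDominated A)
    {μ : Measure (Shift N)} [IsProbabilityMeasure μ] (hμ : IsQuasiBernoulli μ) :
    ∃ c, ∀ i, AlmostAdditive c (basePotential A μ i) := by
  obtain ⟨c₁, h₁⟩ := hμ.exists_almostAdditive
  obtain ⟨c₂, h₂⟩ := hA.exists_almostAdditive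
  have hc₁ := h₁.nonneg
  have hc₂ := h₂.nonneg
  refine ⟨c₁ + c₂, fun i => ?_⟩
  fin_cases i
  · exact h₁.mono (by linarith)
  · exact h₂.mono (by linarith)
  · exact (almostAdditive_log_wordDet A).mono (by linarith)

/-- The exponent is locally one affine branch; its slope jumps at `1` and `2`. -/
lemma differentiableAt_normExponent {s : ℝ} (h1 : s ≠ 1) (h2 : s ≠ 2) :
    DifferentiableAt ℝ normExponent s := by
  rcases lt_or_gt_of_ne h1 with h1 | h1
  · refine differentiableAt_id.congr_of_eventuallyEq ?_
    filter_upwards [gt_mem_nhds h1] with t ht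
    simp [normExponent, ht]
  rcases lt_or_gt_of_ne h2 with h2 | h2
  · refine (differentiableAt_id.const_sub 2).congr_of_eventuallyEq ?_
    filter_upwards [lt_mem_nhds h1, gt_mem_nhds h2] with t ht ht'
    simp [normExponent, not_lt.2 ht.le, ht']
  · refine (differentiableAt_const (0 : ℝ)).congr_of_eventuallyEq ?_
    filter_upwards [lt_mem_nhds h2] with t ht
    simp [normExponent, not_lt.2 ht.le, not_lt.2 (one_le_two.trans ht.le)]

lemma differentiableAt_detExponent {s : ℝ} (h1 : s ≠ 1) (h2 : s ≠ 2) :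
    DifferentiableAt ℝ detExponent s := by
  rcases lt_or_gt_of_ne h1 with h1 | h1
  · refine (differentiableAt_const (0 : ℝ)).congr_of_eventuallyEq ?_
    filter_upwards [gt_mem_nhds h1] with t ht
    simp [detExponent, ht]
  rcases lt_or_gt_of_ne h2 with h2 | h2
  · refine (differentiableAt_id.sub_const 1).congr_of_eventuallyEq ?_
    filter_upwards [lt_mem_nhds h1, gt_mem_nhds h2] with t ht ht'
    simp [detExponent, not_lt.2 ht.le, ht']
  · refine (differentiableAt_id.div_const 2).congr_of_eventuallyEq ?_
    filter_upwards [lt_mem_nhds h2] with t ht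
    simp [detExponent, not_lt.2 ht.le, not_lt.2 (one_le_two.trans ht.le)]

lemma differentiableAt_psiCoeff {p : ℝ × ℝ} (h1 : p.2 ≠ 1) (h2 : p.2 ≠ 2) :
    DifferentiableAt ℝ psiCoeff p := by
  have hn := (differentiableAt_normExponent h1 h2).comp p differentiableAt_snd
  have hd := (differentiableAt_detExponent h1 h2).comp p differentiableAt_snd
  have hq : DifferentiableAt ℝ (fun p : ℝ × ℝ => 1 - p.1) p := differentiableAt_fst.const_sub 1
  rw [differentiableAt_pi]
  intro i
  fin_cases i
  · exact differentiableAt_fst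
  · exact hq.mul hn
  · exact hq.mul hd

end

end SymbolicPressure

theorem mainTheorem5 {N : ℕ} (A : Fin N → GL (Fin 2) ℝ)
    (hcontr : SymbolicPressure.IsContractive A) (hdom : SymbolicPressure.IsDominated A)
    (μ : Measure (SymbolicPressure.Shift N)) [IsProbabilityMeasure μ]
    (hμ : SymbolicPressure.IsQuasiBernoulli μ) :
    (∀ q s : ℝ, 0 ≤ s →
      Tendsto (SymbolicPressure.logPartition (SymbolicPressure.psi A μ q s)) atTop
        (𝓝 (SymbolicPressure.pressure (SymbolicPressure.psi A μ q s)))) ∧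
    DifferentiableOn ℝ
      (fun p : ℝ × ℝ => SymbolicPressure.pressure (SymbolicPressure.psi A μ p.1 p.2))
      (Set.univ ×ˢ (Set.Ioi 0 \ {1, 2})) := by
  -- For `N = 0` the shift space is empty and carries no probability measure. Positivity of the
  -- partition functions needs `N ≠ 0`.
  have : NeZero N := ⟨by
    rintro rfl
    obtain ⟨x⟩ : Nonempty (SymbolicPressure.Shift 0) := nonempty_of_isProbabilityMeasure μ
    exact (x 0).elim0⟩
  obtain ⟨c, hf⟩ := SymbolicPressure.exists_almostAdditive_basePotential hdom hμ
  choose Q hQ using fun x => (SymbolicPressure.AlmostAdditive.sum hf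
    x).exists_abs_log_partitionSum_le
  have hlim (q s : ℝ) : Tendsto (SymbolicPressure.logPartition (SymbolicPressure.psi A μ q s))
      atTop (𝓝 (Q (SymbolicPressure.psiCoeff (q, s)))) := by
    rw [SymbolicPressure.psi_eq_exp A hμ]
    exact SymbolicPressure.tendsto_logPartition_exp (hQ _)
  have hP (q s : ℝ) : SymbolicPressure.pressure (SymbolicPressure.psi A μ q s) =
      Q (SymbolicPressure.psiCoeff (q, s)) := (hlim q s).limUnder_eq
  refine ⟨fun q s _ => ?_, ?_⟩
  · rw [hP]
    exact hlim q s
  · simp only [hP]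
    rintro p ⟨-, -, hp⟩
    simp only [Set.mem_insert_iff, Set.mem_singleton_iff, not_or] at hp
    exact ((SymbolicPressure.differentiable_of_abs_log_partitionSum_le hf hQ _).comp p
      (SymbolicPressure.differentiableAt_psiCoeff hp.1 hp.2)).differentiableWithinAt
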